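/- Consider the memoryless complex-valued channel $$\mathbf Y=\mathbf X+\sqrt{\mathsf I}\,e^{j\Theta}+\mathbf Z ,$$ where the input $\mathbf X$ is a complex random variable with $\mathbb E[|\mathbf X|^2]\le \mathsf S$, the phase $\Theta$ is uniformly distributed on $[0,2\pi]$, $\mathbf Z$ is zero-mean proper-complex (circularly symmetric) Gaussian with $\mathbb E[|\mathbf Z|^2]=1$, and $\mathbf X,\Theta,\mathbf Z$ are mutually independent. Here $\mathsf S\ge 0$ is the signal-to-noise ratio and $\mathsf I\ge 0$ the interference-to-noise ratio. Let $I(\mathbf X;\mathbf Y)$ denote mutual information, let $\log$ be the natural logarithm (rates in nats), and let $$\mathsf C(\mathsf S,\mathsf I)=\sup_{F_{\mathbf X}:\ \mathbb E[|\mathbf X|^2]\le \mathsf S} I(\mathbf X;\mathbf Y)$$ be the capacity, the supremum being over all laws $F_{\mathbf X}$ of $\mathbf X$ on $\mathbb C$ that satisfy the power constraint. Then for every $\mathsf S\ge 0$: 1. $\displaystyle\lim_{\mathsf I\to\infty}\mathsf C(\mathsf S,\mathsf I)=\tfrac12\log(1+\mathsf S)$, which is half the capacity $\mathsf C(\mathsf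 S,0)=\log(1+\mathsf S)$ of the interference-free channel (half the degrees of freedom). 2. For every fixed input law with $\mathbb E[|\mathbf X|^2]\le \mathsf S$, $\displaystyle\limsup_{\mathsf I\to\infty} I(\mathbf X;\mathbf Y)\le \tfrac12\log(1+\mathsf S)$. 3. The zero-mean proper-complex Gaussian input $\mathbf X_G$ with $\mathbb E[|\mathbf X_G|^2]=\mathsf S$ satisfies the power constraint and asymptotically achieves the limit: $\displaystyle\lim_{\mathsf I\to\infty} I(\mathbf X_G;\mathbf Y)=\tfrac12\log(1+\mathsf S)$. -/

import Mathlib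

open MeasureTheory ProbabilityTheory InformationTheory Filter Topology
open scoped NNReal ENNReal

noncomputable section

namespace RadarChannel

/-- Zero-mean proper-complex (circularly symmetric) Gaussian law on `ℂ` with variance
`E|Z|² = v`: independent real and imaginary parts, each of law `N(0, v/2)`. -/
def complexGaussian (v : ℝ≥0) : Measure ℂ :=
  ((gaussianReal 0 (v / 2)).prod (gaussianReal 0 (v / 2))).map
    (fun p : ℝ × ℝ => (⟨p.1, p.2⟩ : ℂ))

/-- The uniform probability law on `[0, 2π]`. -/
def uniformPhase : Measure ℝ :=
  ProbabilityTheory.cond volume (Set.Icc 0 (2 * Real.pi))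

/-- The channel `Y = X + √inr · exp(jΘ) + Z` as a function of `(X, Θ, Z)`. -/
def channelOutput (inr : ℝ) (x : ℂ) (θ : ℝ) (z : ℂ) : ℂ :=
  x + ((Real.sqrt inr : ℂ) * Complex.exp ((θ : ℂ) * Complex.I) + z)

/-- The joint law of the pair (input, output) when `X` has law `F`, `Θ` is uniform on `[0, 2π]`,
`Z` is proper-complex Gaussian of unit variance, and `X`, `Θ`, `Z` are mutually independent. -/
def inputOutputLaw (F : Measure ℂ) (inr : ℝ) : Measure (ℂ × ℂ) :=
  (F.prod (uniformPhase.prod (complexGaussian 1))).map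
    (fun p : ℂ × ℝ × ℂ => (p.1, channelOutput inr p.1 p.2.1 p.2.2))

/-- Mutual information (in nats) of a pair of random variables with joint law `P`: the relative
entropy of `P` with respect to the product of its marginals. -/
def mutualInformation {α β : Type*} [MeasurableSpace α] [MeasurableSpace β]
    (P : Measure (α × β)) : ℝ≥0∞ :=
  klDiv P (P.fst.prod P.snd)

/-- `I(X;Y)` for an input `X` of law `F` at interference-to-noise ratio `inr`. -/
def inputOutputInformation (F : Measure ℂ) (inr : ℝ) : ℝ≥0∞ :=
  mutualInformation (inputOutputLaw F inr)

/-- `F` is the law of an input `X` with `E|X|² ≤ S`. -/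
def IsAdmissibleInput (S : ℝ≥0) (F : Measure ℂ) : Prop :=
  IsProbabilityMeasure F ∧ ∫⁻ x, ‖x‖ₑ ^ 2 ∂F ≤ (S : ℝ≥0∞)

/-- The capacity `C(S, inr)`: supremum of `I(X;Y)` over all inputs with `E|X|² ≤ S`. -/
def capacity (S : ℝ≥0) (inr : ℝ) : ℝ≥0∞ :=
  ⨆ (F : Measure ℂ) (_ : IsAdmissibleInput S F), inputOutputInformation F inr

end RadarChannel

end

/-!
The interference and the Gaussian noise together form a noise `W = √I e^{jΘ} + Z` concentrated near
the circle of radius `r = √I`, and `I(X; X + W) ≤ E A(X + W) - h(W)` for every function `A` with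
`∫ exp (-A) ≤ 1`.

Upper bound: let `A` be rotation invariant, with a radial part which is Gaussian near `r` and only
exponential far out. Around a large circle, only the component of `X + Z` along `e^{jΘ}` changes
the modulus of `r e^{jΘ} + X + Z`, and it carries half of the power of `X + Z`. Hence
`E A(X + W) ≤ log r + log (2π) + log (π (S + 1)) / 2 + 1/2 + o(1)` uniformly over the admissible
inputs, as the linear growth of the radial part makes a bound on the second moment sufficient.

Lower bound: if `Z` is Gaussian of variance `v`, then `Θ` is estimated by the phase of `W` with an
error that is asymptotically the tangential component of `Z` divided by `r`. The mutual information
between `Θ` and `W` obtained in this way gives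
`h(W) ≥ log r + log (2π) + log (π v) / 2 + 1/2 - o(1)`, which matches the upper bound.

A Gaussian input turns `v = 1` into `v = S + 1`, and the two asymptotic expansions differ by
`log (1 + S) / 2`.
-/

noncomputable section

namespace RadarChannel

theorem map_withDensity_comp {α β : Type*} [MeasurableSpace α] [MeasurableSpace β] {μ : Measure α}
    {ν : Measure β} {T : α → β} (hT : MeasurePreserving T μ ν) {f : β → ℝ≥0∞}
    (hf : Measurable f) : (μ.withDensity (f ∘ T)).map T = ν.withDensity f := by
  ext s hs
  rw [Measure.map_apply hT.measurable hs, withDensity_apply _ (hT.measurable hs),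
    withDensity_apply _ hs, ← hT.setLIntegral_comp_preimage hs hf]
  rfl

section KullbackLeibler

variable {α β : Type*} [MeasurableSpace α] [MeasurableSpace β]

theorem klDiv_eq_of_eq_withDensity_exp {P Q : Measure α} [IsFiniteMeasure Q]
    {g : α → ℝ} (hg : Measurable g)
    (hP : P = Q.withDensity fun x => ENNReal.ofReal (Real.exp (g x))) (hint : Integrable g P) :
    klDiv P Q = ENNReal.ofReal (∫ x, g x ∂P + Q.real Set.univ - P.real Set.univ) := by
  have hac : P ≪ Q := hP ▸ withDensity_absolutelyContinuous _ _
  have hllr : llr P Q =ᵐ[P] g := by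
    have hrn : P.rnDeriv Q =ᵐ[Q] fun x => ENNReal.ofReal (Real.exp (g x)) :=
      hP ▸ Measure.rnDeriv_withDensity Q hg.exp.ennreal_ofReal
    filter_upwards [hac hrn] with x hx
    rw [llr, hx, ENNReal.toReal_ofReal (Real.exp_nonneg _), Real.log_exp]
  rw [klDiv_of_ac_of_integrable hac (hint.congr hllr.symm), integral_congr_ae hllr]

-- The defect is `klDiv P.snd Q`, by the chain rule for the disintegration of `P` along its
-- second marginal.
theorem mutualInformation_le_klDiv_prod [StandardBorelSpace α] [Nonempty α] (P : Measure (α × β))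
    [IsProbabilityMeasure P] (Q : Measure β) [IsFiniteMeasure Q] :
    mutualInformation P ≤ klDiv P (P.fst.prod Q) := by
  set R := P.map Prod.swap with hR
  have : IsProbabilityMeasure R := Measure.isProbabilityMeasure_map measurable_swap.aemeasurable
  have hchain : klDiv R (Q.prod P.fst) = klDiv R.fst Q + klDiv R (R.fst.prod P.fst) := by
    have := klDiv_compProd_eq_add (μ := R.fst) (ν := Q) (κ := R.condKernel)
      (η := Kernel.const β P.fst)
    rwa [R.disintegrate R.condKernel, Measure.compProd_const, Measure.compProd_const] at this
  calc mutualInformation P = klDiv (R.map Prod.swap) ((R.fst.prod P.fst).map Prod.swap) := by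
        rw [mutualInformation, Measure.prod_swap, hR, Measure.fst_map_swap,
          Measure.map_map measurable_swap measurable_swap, Prod.swap_swap_eq, Measure.map_id]
    _ ≤ klDiv R (R.fst.prod P.fst) := klDiv_map_le _ _ measurable_swap
    _ ≤ klDiv R (Q.prod P.fst) := hchain ▸ le_add_self
    _ ≤ klDiv P (P.fst.prod Q) := by
        rw [← Measure.prod_swap]
        exact klDiv_map_le _ _ measurable_swap

theorem integral_nonneg_of_lintegral_exp_neg_le_one {P : Measure α} [IsProbabilityMeasure P]
    {f : α → ℝ} (hf : Integrable f P)
    (hexp : ∫⁻ x, ENNReal.ofReal (Real.exp (-f x)) ∂P ≤ 1) : 0 ≤ ∫ x, f x ∂P := by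
  have hmeas : AEStronglyMeasurable (fun x => Real.exp (-f x)) P :=
    (Real.continuous_exp.comp continuous_neg).comp_aestronglyMeasurable hf.1
  have hint : Integrable (fun x => Real.exp (-f x)) P :=
    (lintegral_ofReal_ne_top_iff_integrable hmeas
      (Eventually.of_forall fun x => (Real.exp_pos _).le)).1 (hexp.trans_lt ENNReal.one_lt_top).ne
  have hle : ∫ x, Real.exp (-f x) ∂P ≤ 1 := by
    rw [integral_eq_lintegral_of_nonneg_ae (Eventually.of_forall fun x => (Real.exp_pos _).le)
      hmeas]
    exact ENNReal.toReal_le_of_le_ofReal zero_le_one (by simpa using hexp)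
  have hmono : ∫ x, (1 - f x) ∂P ≤ ∫ x, Real.exp (-f x) ∂P :=
    integral_mono ((integrable_const 1).sub hf) hint fun x => by
      have := Real.add_one_le_exp (-f x)
      simp only
      linarith
  rw [integral_sub (integrable_const 1) hf, integral_const, probReal_univ, one_smul] at hmono
  linarith

end KullbackLeibler

section Entropy

variable {E : Type*} [MeasureSpace E] {μ : Measure E} {A B : E → ℝ}

/-- The differential entropy `h(μ) = -∫ log (dμ/dx) dμ` of a law `μ` (in nats). -/
def differentialEntropy (μ : Measure E) : ℝ :=
  ∫ x, -Real.log (μ.rnDeriv volume x).toReal ∂μ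

/-- `B` is a surprisal of `μ`: an integrable function such that `exp (-B)` is a density of `μ`.
Writing densities in this form makes them positive and their logarithms integrable. -/
structure HasSurprisal (μ : Measure E) (B : E → ℝ) : Prop where
  measurable : Measurable B
  eq_withDensity : μ = volume.withDensity fun y => ENNReal.ofReal (Real.exp (-B y))
  integrable : Integrable B μ

namespace HasSurprisal

theorem differentialEntropy_eq [SigmaFinite (volume : Measure E)] (h : HasSurprisal μ B) :
    differentialEntropy μ = ∫ y, B y ∂μ := by
  have hac : μ ≪ volume := h.eq_withDensity ▸ withDensity_absolutelyContinuous _ _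
  have hrn : μ.rnDeriv volume =ᵐ[volume] fun y => ENNReal.ofReal (Real.exp (-B y)) :=
    h.eq_withDensity ▸ Measure.rnDeriv_withDensity volume h.measurable.neg.exp.ennreal_ofReal
  refine integral_congr_ae ?_
  filter_upwards [hac hrn] with y hy
  rw [hy, ENNReal.toReal_ofReal (Real.exp_nonneg _), Real.log_exp, neg_neg]

theorem lintegral_eq (h : HasSurprisal μ B) {f : E → ℝ≥0∞} (hf : Measurable f) :
    ∫⁻ y, f y ∂μ = ∫⁻ y, ENNReal.ofReal (Real.exp (-B y)) * f y := by
  conv_lhs => rw [h.eq_withDensity]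
  exact lintegral_withDensity_eq_lintegral_mul _ h.measurable.neg.exp.ennreal_ofReal hf

theorem lintegral_exp_neg_eq_one [IsProbabilityMeasure μ] (h : HasSurprisal μ B) :
    ∫⁻ y, ENNReal.ofReal (Real.exp (-B y)) = 1 := by
  simpa using (h.lintegral_eq (measurable_const (a := (1 : ℝ≥0∞)))).symm

theorem differentialEntropy_le [SigmaFinite (volume : Measure E)] [IsProbabilityMeasure μ]
    (h : HasSurprisal μ B) (hA : Measurable A) (hAint : Integrable A μ)
    (hexp : ∫⁻ y, ENNReal.ofReal (Real.exp (-A y)) ≤ 1) :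
    differentialEntropy μ ≤ ∫ y, A y ∂μ := by
  have hnonneg : 0 ≤ ∫ y, (A y - B y) ∂μ := by
    refine integral_nonneg_of_lintegral_exp_neg_le_one (hAint.sub h.integrable) ?_
    have hB := h.measurable
    rw [h.lintegral_eq (f := fun y => ENNReal.ofReal (Real.exp (-(A y - B y)))) (by fun_prop)]
    refine (lintegral_congr fun y => ?_).trans_le hexp
    rw [← ENNReal.ofReal_mul (Real.exp_nonneg _), ← Real.exp_add]
    ring_nf
  rw [integral_sub hAint h.integrable] at hnonneg
  rw [h.differentialEntropy_eq]
  linarith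

end HasSurprisal

end Entropy

section AdditiveNoise

variable {G : Type*} [MeasureSpace G] [AddGroup G] {F N : Measure G} {A B : G → ℝ}

/-- The joint law of the input `X` and the output `X + W` of a channel with additive noise `W`,
where `X` and `W` are independent with laws `F` and `N`. -/
def additiveNoiseLaw (F N : Measure G) : Measure (G × G) :=
  (F.prod N).map fun p => (p.1, p.1 + p.2)

theorem snd_additiveNoiseLaw : (additiveNoiseLaw F N).snd = F ∗ N := by
  rw [additiveNoiseLaw, Measure.snd_map_prodMk (by fun_prop), Measure.conv]

variable [MeasurableAdd₂ G]

theorem isProbabilityMeasure_additiveNoiseLaw [IsProbabilityMeasure F] [IsProbabilityMeasure N] :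
    IsProbabilityMeasure (additiveNoiseLaw F N) :=
  Measure.isProbabilityMeasure_map (by fun_prop)

theorem fst_additiveNoiseLaw [IsProbabilityMeasure N] : (additiveNoiseLaw F N).fst = F := by
  rw [additiveNoiseLaw, Measure.fst_map_prodMk (by fun_prop), Measure.map_fst_prod,
    measure_univ, one_smul]

variable [MeasurableNeg G]

theorem measurePreserving_neg_fst_add_snd_additiveNoiseLaw [IsProbabilityMeasure F] [SFinite N] :
    MeasurePreserving (fun p : G × G => -p.1 + p.2) (additiveNoiseLaw F N) N := by
  refine ⟨by fun_prop, ?_⟩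
  rw [additiveNoiseLaw, Measure.map_map (by fun_prop) (by fun_prop)]
  simp only [Function.comp_def, neg_add_cancel_left, Measure.map_snd_prod, measure_univ, one_smul]

variable [SigmaFinite (volume : Measure G)] [(volume : Measure G).IsAddLeftInvariant]

theorem HasSurprisal.additiveNoiseLaw_eq_withDensity [SFinite F] (hN : HasSurprisal N B) :
    additiveNoiseLaw F N = (F.prod volume).withDensity
      fun p => ENNReal.ofReal (Real.exp (-B (-p.1 + p.2))) := by
  have hB := hN.measurable
  rw [← map_withDensity_comp (measurePreserving_prod_add F volume) (by fun_prop),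
    additiveNoiseLaw]
  conv_lhs => rw [hN.eq_withDensity, prod_withDensity_right (by fun_prop)]
  simp only [Function.comp_def, neg_add_cancel_left]

theorem HasSurprisal.additiveNoiseLaw_eq_withDensity_prod [SFinite F] (hN : HasSurprisal N B)
    (hA : Measurable A) :
    additiveNoiseLaw F N =
      (F.prod (volume.withDensity fun y => ENNReal.ofReal (Real.exp (-A y)))).withDensity
        fun p => ENNReal.ofReal (Real.exp (A p.2 - B (-p.1 + p.2))) := by
  have hB := hN.measurable
  rw [hN.additiveNoiseLaw_eq_withDensity, prod_withDensity_right (by fun_prop),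
    ← withDensity_mul _ (by fun_prop) (by fun_prop)]
  congr 1 with p
  rw [Pi.mul_apply, ← ENNReal.ofReal_mul (Real.exp_nonneg _), ← Real.exp_add]
  ring_nf

theorem HasSurprisal.conv_eq_withDensity [SFinite F] (hN : HasSurprisal N B) :
    F ∗ N = volume.withDensity
      fun y => ∫⁻ x, ENNReal.ofReal (Real.exp (-B (-x + y))) ∂F := by
  have hB := hN.measurable
  rw [← snd_additiveNoiseLaw, hN.additiveNoiseLaw_eq_withDensity]
  ext s hs
  rw [Measure.snd_apply hs, withDensity_apply _ (measurable_snd hs), withDensity_apply _ hs,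
    ← Set.univ_prod, ← Measure.prod_restrict, Measure.restrict_univ,
    lintegral_prod_symm _ (by fun_prop)]

variable [IsProbabilityMeasure F] [IsProbabilityMeasure N]

theorem HasSurprisal.klDiv_additiveNoiseLaw (hN : HasSurprisal N B) (hA : Measurable A)
    (hAint : Integrable A (F ∗ N))
    [IsFiniteMeasure (volume.withDensity fun y => ENNReal.ofReal (Real.exp (-A y)))] :
    klDiv (additiveNoiseLaw F N)
        (F.prod (volume.withDensity fun y => ENNReal.ofReal (Real.exp (-A y)))) =
      ENNReal.ofReal (∫ y, A y ∂(F ∗ N) - differentialEntropy N +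
        (volume.withDensity fun y => ENNReal.ofReal (Real.exp (-A y))).real Set.univ - 1) := by
  have hB := hN.measurable
  have := isProbabilityMeasure_additiveNoiseLaw (F := F) (N := N)
  have hsnd : MeasurePreserving Prod.snd (additiveNoiseLaw F N) (F ∗ N) :=
    ⟨measurable_snd, snd_additiveNoiseLaw⟩
  have hnoise := measurePreserving_neg_fst_add_snd_additiveNoiseLaw (F := F) (N := N)
  have hA' : Integrable (fun p : G × G => A p.2) (additiveNoiseLaw F N) :=
    (hsnd.integrable_comp hAint.1).2 hAint
  have hB' : Integrable (fun p : G × G => B (-p.1 + p.2)) (additiveNoiseLaw F N) :=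
    (hnoise.integrable_comp hN.integrable.1).2 hN.integrable
  have hAeq : ∫ p, A p.2 ∂(additiveNoiseLaw F N) = ∫ y, A y ∂(F ∗ N) := by
    conv_rhs => rw [← hsnd.map_eq, integral_map hsnd.aemeasurable hA.aestronglyMeasurable]
  have hBeq : ∫ p, B (-p.1 + p.2) ∂(additiveNoiseLaw F N) = ∫ w, B w ∂N := by
    conv_rhs => rw [← hnoise.map_eq, integral_map hnoise.aemeasurable hB.aestronglyMeasurable]
  rw [klDiv_eq_of_eq_withDensity_exp (by fun_prop)
    (hN.additiveNoiseLaw_eq_withDensity_prod hA) (hA'.sub hB'), integral_sub hA' hB', hAeq,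
    hBeq, hN.differentialEntropy_eq, probReal_univ (μ := additiveNoiseLaw F N),
    ← Set.univ_prod_univ, measureReal_prod_prod, probReal_univ, one_mul]

theorem HasSurprisal.mutualInformation_additiveNoiseLaw_le [StandardBorelSpace G]
    (hN : HasSurprisal N B) (hA : Measurable A) (hAint : Integrable A (F ∗ N))
    (hexp : ∫⁻ y, ENNReal.ofReal (Real.exp (-A y)) ≤ 1) :
    mutualInformation (additiveNoiseLaw F N) ≤
      ENNReal.ofReal (∫ y, A y ∂(F ∗ N) - differentialEntropy N) := by
  have := isProbabilityMeasure_additiveNoiseLaw (F := F) (N := N)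
  set Q := (volume : Measure G).withDensity fun y => ENNReal.ofReal (Real.exp (-A y)) with hQ
  have hQuniv : Q Set.univ ≤ 1 := by simpa [hQ] using hexp
  have : IsFiniteMeasure Q := ⟨hQuniv.trans_lt ENNReal.one_lt_top⟩
  have hQreal : Q.real Set.univ ≤ 1 := ENNReal.toReal_le_of_le_ofReal zero_le_one (by simpa)
  calc mutualInformation (additiveNoiseLaw F N)
      ≤ klDiv (additiveNoiseLaw F N) (F.prod Q) := by
        simpa only [fst_additiveNoiseLaw] using
          mutualInformation_le_klDiv_prod (additiveNoiseLaw F N) Q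
    _ = ENNReal.ofReal (∫ y, A y ∂(F ∗ N) - differentialEntropy N + Q.real Set.univ - 1) :=
        hN.klDiv_additiveNoiseLaw hA hAint
    _ ≤ _ := ENNReal.ofReal_le_ofReal (by linarith)

theorem HasSurprisal.mutualInformation_additiveNoiseLaw (hN : HasSurprisal N B)
    (hA : HasSurprisal (F ∗ N) A) :
    mutualInformation (additiveNoiseLaw F N) =
      ENNReal.ofReal (differentialEntropy (F ∗ N) - differentialEntropy N) := by
  have : IsProbabilityMeasure
      (volume.withDensity fun y => ENNReal.ofReal (Real.exp (-A y))) :=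
    hA.eq_withDensity ▸ inferInstance
  rw [mutualInformation, fst_additiveNoiseLaw, snd_additiveNoiseLaw, hA.differentialEntropy_eq]
  conv_lhs => rw [hA.eq_withDensity]
  rw [hN.klDiv_additiveNoiseLaw hA.measurable hA.integrable, probReal_univ, add_sub_cancel_right]

theorem HasSurprisal.conv (hN : HasSurprisal N B) {m : ℝ} {C : G → ℝ} (hm : ∀ w, m ≤ B w)
    (hBC : ∀ y, ∀ᵐ x ∂F, B (-x + y) ≤ C y) (hC : Integrable C (F ∗ N)) :
    HasSurprisal (F ∗ N) fun y => -Real.log (∫ x, Real.exp (-B (-x + y)) ∂F) := by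
  have hB := hN.measurable
  have hmeas : Measurable fun y => ∫ x, Real.exp (-B (-x + y)) ∂F :=
    (StronglyMeasurable.integral_prod_left (f := fun x y => Real.exp (-B (-x + y)))
      (by fun_prop : Measurable fun p : G × G => Real.exp (-B (-p.1 + p.2))).stronglyMeasurable
      ).measurable
  have hle (w : G) : Real.exp (-B w) ≤ Real.exp (-m) := Real.exp_le_exp.2 (neg_le_neg (hm w))
  have hint (y : G) : Integrable (fun x => Real.exp (-B (-x + y))) F :=
    (integrable_const (Real.exp (-m))).mono' (by fun_prop : Measurable _).aestronglyMeasurable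
      (Eventually.of_forall fun x => by
        rw [Real.norm_eq_abs, Real.abs_exp]
        exact hle _)
  have hlower (y : G) : Real.exp (-C y) ≤ ∫ x, Real.exp (-B (-x + y)) ∂F := by
    have := integral_mono_ae (integrable_const (Real.exp (-C y))) (hint y)
      ((hBC y).mono fun x hx => Real.exp_le_exp.2 (neg_le_neg hx))
    simpa using this
  have hupper (y : G) : ∫ x, Real.exp (-B (-x + y)) ∂F ≤ Real.exp (-m) := by
    have := integral_mono (hint y) (integrable_const (Real.exp (-m))) fun x => hle _
    simpa using this
  have hpos (y : G) := (Real.exp_pos _).trans_le (hlower y)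
  refine ⟨hmeas.log.neg, ?_, ?_⟩
  · rw [hN.conv_eq_withDensity]
    congr 1 with y
    rw [neg_neg, Real.exp_log (hpos y),
      ofReal_integral_eq_lintegral_ofReal (hint y)
        (Eventually.of_forall fun x => Real.exp_nonneg _)]
  · refine ((integrable_const |m|).add hC.abs).mono' hmeas.log.neg.aestronglyMeasurable
      (Eventually.of_forall fun y => abs_le.2 ⟨?_, ?_⟩)
    · have h := Real.log_le_log (hpos y) (hupper y)
      rw [Real.log_exp] at h
      simp only [Pi.add_apply]
      linarith [neg_abs_le m, abs_nonneg (C y)]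
    · have h := Real.log_le_log (Real.exp_pos _) (hlower y)
      rw [Real.log_exp] at h
      simp only [Pi.add_apply]
      linarith [le_abs_self (C y), abs_nonneg m]

end AdditiveNoise

section Convolution

variable {E : Type*} [NormedAddCommGroup E] [MeasurableSpace E] {μ ν : Measure E}

theorem integrable_norm_sq_of_memLp (hμ : MemLp id 2 μ) : Integrable (fun x => ‖x‖ ^ 2) μ :=
  hμ.integrable_norm_pow two_ne_zero

variable [BorelSpace E] [SecondCountableTopology E] [IsProbabilityMeasure μ]
  [IsProbabilityMeasure ν]

theorem memLp_id_conv {p : ℝ≥0∞} (hμ : MemLp id p μ) (hν : MemLp id p ν) : MemLp id p (μ ∗ ν) := by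
  rw [Measure.conv, memLp_map_measure_iff (by fun_prop) (by fun_prop)]
  exact (hμ.comp_fst ν).add (hν.comp_snd μ)

theorem integral_id_conv [NormedSpace ℝ E] [CompleteSpace E] (hμ : Integrable id μ)
    (hν : Integrable id ν) : ∫ x, x ∂(μ ∗ ν) = ∫ x, x ∂μ + ∫ x, x ∂ν := by
  have hconv : Integrable id (μ ∗ ν) := by
    simpa only [memLp_one_iff_integrable] using
      memLp_id_conv (memLp_one_iff_integrable.2 hμ) (memLp_one_iff_integrable.2 hν)
  have hν' : Integrable (fun y : E => y) ν := hν
  have hμ' : Integrable (fun y : E => y) μ := hμ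
  calc ∫ x, x ∂(μ ∗ ν) = ∫ x, ∫ y, x + y ∂ν ∂μ := integral_conv hconv
    _ = ∫ x, (x + ∫ y, y ∂ν) ∂μ := by
        simp only [integral_add (integrable_const _) hν', integral_const, probReal_univ, one_smul]
    _ = _ := by
        rw [integral_add hμ' (integrable_const _), integral_const, probReal_univ, one_smul]

theorem integral_norm_sq_conv [InnerProductSpace ℝ E] [CompleteSpace E] (hμ : MemLp id 2 μ)
    (hν : MemLp id 2 ν) (hmean : ∫ y, y ∂ν = 0) :
    ∫ x, ‖x‖ ^ 2 ∂(μ ∗ ν) = ∫ x, ‖x‖ ^ 2 ∂μ + ∫ y, ‖y‖ ^ 2 ∂ν := by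
  have hνint : Integrable (fun y : E => y) ν := hν.integrable one_le_two
  have hμsq := integrable_norm_sq_of_memLp hμ
  have hνsq := integrable_norm_sq_of_memLp hν
  have hfiber (x : E) : ∫ y, ‖x + y‖ ^ 2 ∂ν = ‖x‖ ^ 2 + ∫ y, ‖y‖ ^ 2 ∂ν := by
    have hcross : ∫ y, inner ℝ x y ∂ν = 0 := by
      rw [integral_inner hνint, hmean, inner_zero_right]
    have hcrossint : Integrable (fun y => 2 * inner ℝ x y) ν := (hνint.const_inner x).const_mul 2
    simp only [norm_add_sq_real]
    rw [integral_add (f := fun y => ‖x‖ ^ 2 + 2 * inner ℝ x y)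
        ((integrable_const _).add hcrossint) hνsq,
      integral_add (integrable_const _) hcrossint, integral_const_mul, hcross, integral_const,
      probReal_univ, one_smul, mul_zero, add_zero]
  calc ∫ x, ‖x‖ ^ 2 ∂(μ ∗ ν) = ∫ x, ∫ y, ‖x + y‖ ^ 2 ∂ν ∂μ :=
        integral_conv (integrable_norm_sq_of_memLp (memLp_id_conv hμ hν))
    _ = _ := by
        simp only [hfiber]
        rw [integral_add hμsq (integrable_const _), integral_const, probReal_univ, one_smul]

end Convolution

section ComplexGaussian

variable {v : ℝ≥0}

instance : IsProbabilityMeasure (complexGaussian v) :=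
  Measure.isProbabilityMeasure_map Complex.measurableEquivRealProd.symm.measurable.aemeasurable

theorem complexGaussian_eq_conv (v : ℝ≥0) :
    complexGaussian v = (gaussianReal 0 (v / 2)).map Complex.ofRealCLM ∗
      (gaussianReal 0 (v / 2)).map (Complex.I • Complex.ofRealCLM) := by
  rw [Measure.conv, Measure.map_prod_map _ _ (by fun_prop) (by fun_prop),
    Measure.map_map (by fun_prop) (by fun_prop), complexGaussian]
  congr 1 with p
  simp [Complex.mk_eq_add_mul_I, mul_comm]

theorem complexGaussian_conv_complexGaussian (a b : ℝ≥0) :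
    complexGaussian a ∗ complexGaussian b = complexGaussian (a + b) := by
  have hadd (L : ℝ →L[ℝ] ℂ) : (gaussianReal 0 ((a + b) / 2)).map L =
      (gaussianReal 0 (a / 2)).map L ∗ (gaussianReal 0 (b / 2)).map L := by
    rw [← Measure.map_conv_continuousLinearMap, gaussianReal_conv_gaussianReal, add_zero, add_div]
  simp only [complexGaussian_eq_conv, hadd]
  rw [Measure.conv_assoc, Measure.conv_assoc]
  congr 1
  rw [← Measure.conv_assoc, ← Measure.conv_assoc]
  congr 1
  exact Measure.conv_comm _ _

theorem integral_sq_gaussianReal (v : ℝ≥0) : ∫ x, x ^ 2 ∂gaussianReal 0 v = v := by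
  have h := variance_fun_id_gaussianReal (μ := 0) (v := v)
  rw [variance_eq_integral (by fun_prop)] at h
  simpa [integral_id_gaussianReal] using h

instance (L : ℝ →L[ℝ] ℂ) : IsProbabilityMeasure ((gaussianReal 0 v).map L) :=
  Measure.isProbabilityMeasure_map (by fun_prop)

theorem memLp_id_map_gaussianReal (L : ℝ →L[ℝ] ℂ) : MemLp id 2 ((gaussianReal 0 v).map L) :=
  (memLp_map_measure_iff (by fun_prop) (by fun_prop)).2
    (L.comp_memLp' (memLp_id_gaussianReal 2))

theorem integral_id_map_gaussianReal (L : ℝ →L[ℝ] ℂ) :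
    ∫ z, z ∂((gaussianReal 0 v).map L) = 0 := by
  have hint : Integrable (fun x => x) (gaussianReal 0 v) :=
    (memLp_id_gaussianReal (μ := 0) (v := v) 1).integrable le_rfl
  rw [integral_map (by fun_prop) (by fun_prop), L.integral_comp_comm hint,
    integral_id_gaussianReal, map_zero]

theorem memLp_id_complexGaussian : MemLp id 2 (complexGaussian v) := by
  rw [complexGaussian_eq_conv]
  exact memLp_id_conv (memLp_id_map_gaussianReal _) (memLp_id_map_gaussianReal _)

theorem integral_id_complexGaussian : ∫ z, z ∂complexGaussian v = 0 := by
  have hint (L : ℝ →L[ℝ] ℂ) : Integrable id ((gaussianReal 0 (v / 2)).map L) :=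
    (memLp_id_map_gaussianReal L).integrable one_le_two
  rw [complexGaussian_eq_conv, integral_id_conv (hint _) (hint _), integral_id_map_gaussianReal,
    integral_id_map_gaussianReal, add_zero]

theorem integral_norm_sq_complexGaussian : ∫ z, ‖z‖ ^ 2 ∂complexGaussian v = v := by
  rw [complexGaussian_eq_conv, integral_norm_sq_conv (memLp_id_map_gaussianReal _)
    (memLp_id_map_gaussianReal _) (integral_id_map_gaussianReal _),
    integral_map (by fun_prop) (by fun_prop), integral_map (by fun_prop) (by fun_prop)]
  simp [integral_sq_gaussianReal]

theorem isAdmissibleInput_complexGaussian (v : ℝ≥0) :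
    IsAdmissibleInput v (complexGaussian v) := by
  refine ⟨inferInstance, le_of_eq ?_⟩
  have h := ofReal_integral_eq_lintegral_ofReal
    (integrable_norm_sq_of_memLp (memLp_id_complexGaussian (v := v)))
    (ae_of_all _ fun z => by positivity)
  rw [integral_norm_sq_complexGaussian, ENNReal.ofReal_coe_nnreal] at h
  rw [h]
  refine lintegral_congr fun z => ?_
  rw [← ofReal_norm, ENNReal.ofReal_pow (norm_nonneg _)]

/-- The surprisal `log (π v) + |z|² / v` of the proper-complex Gaussian law of variance `v`. -/
def gaussianSurprisal (v : ℝ) (z : ℂ) : ℝ :=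
  Real.log (Real.pi * v) + ‖z‖ ^ 2 / v

@[fun_prop]
theorem measurable_gaussianSurprisal (v : ℝ) : Measurable (gaussianSurprisal v) := by
  unfold gaussianSurprisal
  fun_prop

theorem integrable_gaussianSurprisal (c : ℝ) {μ : Measure ℂ} [IsProbabilityMeasure μ]
    (hμ : MemLp id 2 μ) : Integrable (gaussianSurprisal c) μ :=
  (integrable_const _).add ((integrable_norm_sq_of_memLp hμ).div_const c)

theorem integral_gaussianSurprisal (c : ℝ) {μ : Measure ℂ} [IsProbabilityMeasure μ]
    (hμ : MemLp id 2 μ) :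
    ∫ z, gaussianSurprisal c z ∂μ = Real.log (Real.pi * c) + (∫ z, ‖z‖ ^ 2 ∂μ) / c := by
  unfold gaussianSurprisal
  rw [integral_add (integrable_const _) ((integrable_norm_sq_of_memLp hμ).div_const c),
    integral_const, probReal_univ, one_smul, integral_div]

theorem gaussianPDF_mul_gaussianPDF (hv : v ≠ 0) (x y : ℝ) :
    gaussianPDF 0 (v / 2) x * gaussianPDF 0 (v / 2) y =
      ENNReal.ofReal (Real.exp (-gaussianSurprisal v ⟨x, y⟩)) := by
  have : (0 : ℝ) < v := by positivity
  rw [gaussianPDF, gaussianPDF, ← ENNReal.ofReal_mul (gaussianPDFReal_nonneg _ _ _)]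
  congr 1
  rw [gaussianPDFReal, gaussianPDFReal, gaussianSurprisal, neg_add, Real.exp_add, Real.exp_neg,
    Real.exp_log (by positivity), Complex.sq_norm, Complex.normSq_mk]
  push_cast
  rw [show 2 * Real.pi * ((v : ℝ) / 2) = Real.pi * v by ring, mul_mul_mul_comm, ← mul_inv,
    Real.mul_self_sqrt (by positivity), ← Real.exp_add]
  congr 2
  field_simp
  ring

theorem hasSurprisal_complexGaussian (hv : v ≠ 0) :
    HasSurprisal (complexGaussian v) (gaussianSurprisal v) where
  measurable := measurable_gaussianSurprisal v
  eq_withDensity := by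
    have hv2 : v / 2 ≠ 0 := by positivity
    rw [← map_withDensity_comp (Complex.volume_preserving_equiv_real_prod.symm _) (by fun_prop),
      complexGaussian, gaussianReal_of_var_ne_zero _ hv2,
      prod_withDensity (measurable_gaussianPDF _ _) (measurable_gaussianPDF _ _)]
    simp only [gaussianPDF_mul_gaussianPDF hv]
    rfl
  integrable := integrable_gaussianSurprisal v memLp_id_complexGaussian

theorem differentialEntropy_complexGaussian (hv : v ≠ 0) :
    differentialEntropy (complexGaussian v) = Real.log (Real.pi * v) + 1 := by
  rw [(hasSurprisal_complexGaussian hv).differentialEntropy_eq,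
    integral_gaussianSurprisal _ memLp_id_complexGaussian, integral_norm_sq_complexGaussian,
    div_self (by exact_mod_cast hv)]

end ComplexGaussian

section Phase

theorem uniformPhase_eq_smul :
    uniformPhase =
      ENNReal.ofReal (2 * Real.pi)⁻¹ • volume.restrict (Set.Ioc 0 (2 * Real.pi)) := by
  rw [uniformPhase, ProbabilityTheory.cond, Real.volume_Icc, sub_zero,
    ENNReal.ofReal_inv_of_pos Real.two_pi_pos, Measure.restrict_congr_set Ioc_ae_eq_Icc]

instance : IsProbabilityMeasure uniformPhase :=
  cond_isProbabilityMeasure_of_finite (by simp [Real.pi_pos])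
    (by rw [Real.volume_Icc]; exact ENNReal.ofReal_ne_top)

theorem integral_uniformPhase {E : Type*} [NormedAddCommGroup E] [NormedSpace ℝ E] (f : ℝ → E) :
    ∫ θ, f θ ∂uniformPhase = (2 * Real.pi)⁻¹ • ∫ θ in (0 : ℝ)..2 * Real.pi, f θ := by
  rw [uniformPhase_eq_smul, integral_smul_measure,
    intervalIntegral.integral_of_le Real.two_pi_pos.le,
    ENNReal.toReal_ofReal (inv_nonneg.2 Real.two_pi_pos.le)]

theorem integral_exp_int_mul_uniformPhase {n : ℤ} (hn : n ≠ 0) :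
    ∫ θ : ℝ, Complex.exp (n * Complex.I * θ) ∂uniformPhase = 0 := by
  have hc : (n : ℂ) * Complex.I ≠ 0 := mul_ne_zero (Int.cast_ne_zero.2 hn) Complex.I_ne_zero
  rw [integral_uniformPhase, integral_exp_mul_complex hc]
  have hperiod : Complex.exp (n * Complex.I * ((2 * Real.pi : ℝ) : ℂ)) = 1 :=
    Complex.exp_eq_one_iff.2 ⟨n, by push_cast; ring⟩
  rw [hperiod, Complex.ofReal_zero, mul_zero, Complex.exp_zero, sub_self, zero_div, smul_zero]

theorem integral_re_rotate_sq_uniformPhase (u : ℂ) :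
    ∫ θ : ℝ, (u * Complex.exp (-(θ * Complex.I))).re ^ 2 ∂uniformPhase = ‖u‖ ^ 2 / 2 := by
  have hsq (w : ℂ) : w.re ^ 2 = ‖w‖ ^ 2 / 2 + (w ^ 2).re / 2 := by
    rw [Complex.sq_norm, Complex.normSq_apply, sq w, Complex.mul_re]
    ring
  have hint : Integrable (fun θ : ℝ => u ^ 2 * Complex.exp ((-2 : ℤ) * Complex.I * θ))
      uniformPhase := by
    refine (integrable_const (‖u‖ ^ 2)).mono' (by fun_prop) (Eventually.of_forall fun θ => ?_)
    simp [Complex.norm_exp]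
  have hrot (θ : ℝ) : (u * Complex.exp (-(θ * Complex.I))).re ^ 2 =
      ‖u‖ ^ 2 / 2 + (u ^ 2 * Complex.exp ((-2 : ℤ) * Complex.I * θ)).re / 2 := by
    rw [hsq, mul_pow, ← Complex.exp_nat_mul, norm_mul, ← neg_mul, ← Complex.ofReal_neg,
      Complex.norm_exp_ofReal_mul_I, mul_one]
    push_cast
    ring_nf
  have hint_re : Integrable
      (fun θ : ℝ => (u ^ 2 * Complex.exp ((-2 : ℤ) * Complex.I * θ)).re) uniformPhase := hint.re
  have hre := integral_re hint
  rw [integral_const_mul, integral_exp_int_mul_uniformPhase (by norm_num), mul_zero] at hre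
  simp only [hrot]
  rw [integral_add (integrable_const _) (hint_re.div_const 2), integral_const,
    probReal_univ, one_smul, integral_div]
  simpa using hre

theorem integral_im_rotate_sq_uniformPhase (u : ℂ) :
    ∫ θ : ℝ, (u * Complex.exp (-(θ * Complex.I))).im ^ 2 ∂uniformPhase = ‖u‖ ^ 2 / 2 := by
  have h := integral_re_rotate_sq_uniformPhase (u * -Complex.I)
  simpa [mul_right_comm u (-Complex.I)] using h

end Phase

section Ring

/-- The uniform law on the circle of radius `r` about the origin: the law of `r e^{jΘ}`. -/
def circleLaw (r : ℝ) : Measure ℂ :=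
  uniformPhase.map fun θ : ℝ => r * Complex.exp (θ * Complex.I)

/-- The law of the total noise `r e^{jΘ} + Z`, with `Z` proper-complex Gaussian of variance `v`. -/
def ringLaw (v : ℝ≥0) (r : ℝ) : Measure ℂ :=
  circleLaw r ∗ complexGaussian v

variable {r : ℝ}

instance : IsProbabilityMeasure (circleLaw r) :=
  Measure.isProbabilityMeasure_map (by fun_prop)

instance {v : ℝ≥0} : IsProbabilityMeasure (ringLaw v r) := by
  unfold ringLaw
  infer_instance

theorem ae_norm_eq_circleLaw (r : ℝ) : ∀ᵐ x ∂circleLaw r, ‖x‖ = |r| := by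
  rw [circleLaw, ae_map_iff (by fun_prop) (measurableSet_eq_fun (by fun_prop) (by fun_prop))]
  exact Eventually.of_forall fun θ => by simp [Complex.norm_exp_ofReal_mul_I]

theorem memLp_id_circleLaw (r : ℝ) (p : ℝ≥0∞) : MemLp id p (circleLaw r) :=
  MemLp.of_bound (by fun_prop) |r| ((ae_norm_eq_circleLaw r).mono fun _ hx => hx.le)

theorem integral_id_circleLaw : ∫ x, x ∂circleLaw r = 0 := by
  rw [circleLaw, integral_map (by fun_prop) (by fun_prop), integral_const_mul]
  have h := integral_exp_int_mul_uniformPhase one_ne_zero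
  simp only [Int.cast_one, one_mul, mul_comm Complex.I] at h
  rw [h, mul_zero]

theorem integral_norm_sq_circleLaw : ∫ x, ‖x‖ ^ 2 ∂circleLaw r = r ^ 2 := by
  rw [integral_congr_ae ((ae_norm_eq_circleLaw r).mono fun x hx => by simp only [hx, sq_abs]; rfl),
    integral_const, probReal_univ, one_smul]

theorem circleLaw_zero : circleLaw 0 = Measure.dirac 0 := by
  simp [circleLaw]

theorem ringLaw_zero (v : ℝ≥0) : ringLaw v 0 = complexGaussian v := by
  rw [ringLaw, circleLaw_zero, Measure.dirac_zero_conv]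

theorem inputOutputLaw_eq_additiveNoiseLaw (F : Measure ℂ) [SFinite F] (inr : ℝ) :
    inputOutputLaw F inr = additiveNoiseLaw F (ringLaw 1 (√inr)) := by
  have hring : ringLaw 1 (√inr) = (uniformPhase.prod (complexGaussian 1)).map
      fun p => √inr * Complex.exp (p.1 * Complex.I) + p.2 := by
    conv_lhs => rw [ringLaw, circleLaw, Measure.conv, ← Measure.map_id (μ := complexGaussian 1),
      Measure.map_prod_map _ _ (by fun_prop) (by fun_prop),
      Measure.map_map (by fun_prop) (by fun_prop)]
    rfl
  rw [additiveNoiseLaw, hring]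
  conv_rhs => rw [← Measure.map_id (μ := F), Measure.map_prod_map _ _ (by fun_prop) (by fun_prop),
    Measure.map_map (by fun_prop) (by fun_prop)]
  rfl

theorem conv_ringLaw (F : Measure ℂ) [SFinite F] (v : ℝ≥0) :
    F ∗ ringLaw v r = circleLaw r ∗ (F ∗ complexGaussian v) := by
  rw [ringLaw, ← Measure.conv_assoc, Measure.conv_comm F, Measure.conv_assoc]

theorem complexGaussian_conv_ringLaw (a b : ℝ≥0) :
    complexGaussian a ∗ ringLaw b r = ringLaw (a + b) r := by
  rw [conv_ringLaw, complexGaussian_conv_complexGaussian, ringLaw]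

theorem memLp_id_ringLaw (v : ℝ≥0) (r : ℝ) : MemLp id 2 (ringLaw v r) :=
  memLp_id_conv (memLp_id_circleLaw r 2) memLp_id_complexGaussian

theorem exists_hasSurprisal_ringLaw {v : ℝ≥0} (hv : v ≠ 0) (r : ℝ) :
    ∃ B, HasSurprisal (ringLaw v r) B := by
  have : (0 : ℝ) < v := by positivity
  refine ⟨_, (hasSurprisal_complexGaussian hv).conv (m := Real.log (Real.pi * v))
    (C := fun y => Real.log (Real.pi * v) + 2 * (|r| ^ 2 + ‖y‖ ^ 2) / v) (fun w => ?_)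
    (fun y => ?_) ?_⟩
  · rw [gaussianSurprisal]
    have : 0 ≤ ‖w‖ ^ 2 / v := by positivity
    linarith
  · filter_upwards [ae_norm_eq_circleLaw r] with x hx
    rw [gaussianSurprisal, ← hx]
    gcongr
    calc ‖-x + y‖ ^ 2 ≤ (‖x‖ + ‖y‖) ^ 2 := by
          gcongr
          exact (norm_add_le _ _).trans_eq (by rw [norm_neg])
      _ ≤ _ := add_sq_le
  · exact (integrable_const _).add ((((integrable_const _).add
      (integrable_norm_sq_of_memLp (memLp_id_ringLaw v r))).const_mul 2).div_const _)

end Ring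

section RadialTest

theorem lintegral_norm_complex {f : ℝ → ℝ≥0∞} (hf : Measurable f) :
    ∫⁻ z : ℂ, f ‖z‖ = ENNReal.ofReal (2 * Real.pi) *
      ∫⁻ ρ in Set.Ioi (0 : ℝ), ENNReal.ofReal ρ * f ρ := by
  rw [← Complex.lintegral_comp_polarCoord_symm, polarCoord_target]
  simp only [Complex.norm_polarCoord_symm, smul_eq_mul]
  rw [Measure.volume_eq_prod, ← Measure.prod_restrict, lintegral_prod _ (by fun_prop),
    ← lintegral_const_mul _ (by fun_prop)]
  refine setLIntegral_congr_fun measurableSet_Ioi fun ρ hρ => ?_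
  simp only [abs_of_pos (Set.mem_Ioi.1 hρ), setLIntegral_const, Real.volume_Ioo]
  rw [mul_comm, sub_neg_eq_add, two_mul]

/-- The test surprisal `log (2π) + (log c + |y|²/c - 1)/2 + φ |y|` of a rotation invariant law whose
radial part has surprisal `φ`. The term `log |y|` coming from polar coordinates is replaced by its
tangent bound at `|y|² = c`, which makes the expectation of the test a second moment. -/
def radialTest (c : ℝ) (φ : ℝ → ℝ) (y : ℂ) : ℝ :=
  Real.log (2 * Real.pi) + (Real.log c + ‖y‖ ^ 2 / c - 1) / 2 + φ ‖y‖

variable {c : ℝ} {φ : ℝ → ℝ}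

theorem measurable_radialTest (hφ : Measurable φ) : Measurable (radialTest c φ) := by
  unfold radialTest
  fun_prop

theorem mul_exp_neg_tangent_le_one (hc : 0 < c) {ρ : ℝ} (hρ : 0 < ρ) :
    ρ * Real.exp (-((Real.log c + ρ ^ 2 / c - 1) / 2)) ≤ 1 := by
  have hlog : 2 * Real.log ρ - Real.log c ≤ ρ ^ 2 / c - 1 := by
    have h := Real.log_le_sub_one_of_pos (show 0 < ρ ^ 2 / c by positivity)
    rwa [Real.log_div (by positivity) hc.ne', Real.log_pow] at h
  rw [← Real.exp_log hρ, ← Real.exp_add, Real.exp_le_one_iff, Real.exp_log hρ]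
  linarith

theorem lintegral_exp_neg_radialTest_le_one (hc : 0 < c) (hφ : Measurable φ)
    (hexp : ∫⁻ ρ, ENNReal.ofReal (Real.exp (-φ ρ)) ≤ 1) :
    ∫⁻ y, ENNReal.ofReal (Real.exp (-radialTest c φ y)) ≤ 1 := by
  have h2pi := Real.two_pi_pos
  have hbound (ρ : ℝ) (hρ : 0 < ρ) : ENNReal.ofReal ρ * ENNReal.ofReal
      (Real.exp (-(Real.log (2 * Real.pi) + (Real.log c + ρ ^ 2 / c - 1) / 2 + φ ρ))) ≤
        ENNReal.ofReal (2 * Real.pi)⁻¹ * ENNReal.ofReal (Real.exp (-φ ρ)) := by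
    rw [← ENNReal.ofReal_mul hρ.le, ← ENNReal.ofReal_mul (by positivity)]
    refine ENNReal.ofReal_le_ofReal ?_
    rw [neg_add, neg_add, Real.exp_add, Real.exp_add, Real.exp_neg (Real.log _),
      Real.exp_log h2pi, ← mul_assoc, mul_left_comm]
    gcongr
    exact mul_le_of_le_one_right (by positivity) (mul_exp_neg_tangent_le_one hc hρ)
  unfold radialTest
  rw [lintegral_norm_complex (f := fun ρ => ENNReal.ofReal (Real.exp
    (-(Real.log (2 * Real.pi) + (Real.log c + ρ ^ 2 / c - 1) / 2 + φ ρ)))) (by fun_prop)]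
  calc _ ≤ ENNReal.ofReal (2 * Real.pi) * ∫⁻ ρ in Set.Ioi (0 : ℝ),
        ENNReal.ofReal (2 * Real.pi)⁻¹ * ENNReal.ofReal (Real.exp (-φ ρ)) := by
        exact mul_le_mul_right (setLIntegral_mono (by fun_prop) hbound) _
    _ = ∫⁻ ρ in Set.Ioi (0 : ℝ), ENNReal.ofReal (Real.exp (-φ ρ)) := by
        rw [lintegral_const_mul _ (by fun_prop), ← mul_assoc, ← ENNReal.ofReal_mul h2pi.le,
          mul_inv_cancel₀ h2pi.ne', ENNReal.ofReal_one, one_mul]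
    _ ≤ 1 := (setLIntegral_le_lintegral _ _).trans hexp

theorem lintegral_exp_neg_mul_sq {b : ℝ} (hb : 0 < b) :
    ∫⁻ t, ENNReal.ofReal (Real.exp (-b * t ^ 2)) = ENNReal.ofReal (√(Real.pi / b)) := by
  rw [← ofReal_integral_eq_lintegral_ofReal (integrable_exp_neg_mul_sq hb)
    (Eventually.of_forall fun t => Real.exp_nonneg _), integral_gaussian]

theorem lintegral_exp_neg_mul_abs {b : ℝ} (hb : 0 < b) :
    ∫⁻ t, ENNReal.ofReal (Real.exp (-b * |t|)) = ENNReal.ofReal (2 / b) := by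
  have heq : ∫ t, Real.exp (-b * |t|) = 2 / b := by
    rw [integral_comp_abs (f := fun t => Real.exp (-b * t)),
      integral_exp_mul_Ioi (neg_neg_of_pos hb), mul_zero, Real.exp_zero]
    field_simp
  have hint : Integrable fun t : ℝ => Real.exp (-b * |t|) :=
    .of_integral_ne_zero (by rw [heq]; positivity)
  rw [← heq, ofReal_integral_eq_lintegral_ofReal hint
    (Eventually.of_forall fun t => Real.exp_nonneg _)]

/-- The Huber-type cost `min (t², a |t|)` of a radial deviation `t`. It is quadratic where the
Gaussian tail matters and linear far out, so that second moments control it. -/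
def huberCost (a t : ℝ) : ℝ :=
  min (t ^ 2) (a * |t|)

@[fun_prop]
theorem continuous_huberCost (a : ℝ) : Continuous (huberCost a) := by
  unfold huberCost
  fun_prop

variable {v a : ℝ}

/-- The radial surprisal `log (√(π v) + 2 v / a) + min ((ρ - r)², a |ρ - r|) / v`. The constant
comes from integrating the Gaussian and the Laplace density separately, so `exp (-huberSurprisal)`
has integral at most `1`, not equal to `1`. -/
def huberSurprisal (v a r ρ : ℝ) : ℝ :=
  Real.log (√(Real.pi * v) + 2 * v / a) + huberCost a (ρ - r) / v

@[fun_prop]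
theorem continuous_huberSurprisal (v a r : ℝ) : Continuous (huberSurprisal v a r) := by
  unfold huberSurprisal
  fun_prop

theorem lintegral_exp_neg_huberSurprisal_le_one (hv : 0 < v) (ha : 0 < a) (r : ℝ) :
    ∫⁻ ρ, ENNReal.ofReal (Real.exp (-huberSurprisal v a r ρ)) ≤ 1 := by
  set K := √(Real.pi * v) + 2 * v / a
  have hKpos : 0 < K := by positivity
  have hcost (t : ℝ) : ENNReal.ofReal (Real.exp (-(huberCost a t / v))) ≤
      ENNReal.ofReal (Real.exp (-v⁻¹ * t ^ 2)) + ENNReal.ofReal (Real.exp (-(a / v) * |t|)) := by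
    rcases min_choice (t ^ 2) (a * |t|) with h | h
    · refine le_add_right (le_of_eq ?_)
      rw [huberCost, h]
      ring_nf
    · refine le_add_left (le_of_eq ?_)
      rw [huberCost, h]
      ring_nf
  calc ∫⁻ ρ, ENNReal.ofReal (Real.exp (-huberSurprisal v a r ρ))
      = ∫⁻ ρ, ENNReal.ofReal K⁻¹ * ENNReal.ofReal (Real.exp (-(huberCost a (ρ - r) / v))) := by
        refine lintegral_congr fun ρ => ?_
        rw [huberSurprisal, neg_add, Real.exp_add, Real.exp_neg (Real.log _),
          Real.exp_log hKpos, ENNReal.ofReal_mul (by positivity)]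
    _ = ENNReal.ofReal K⁻¹ * ∫⁻ t, ENNReal.ofReal (Real.exp (-(huberCost a t / v))) := by
        rw [lintegral_const_mul _ (by fun_prop), lintegral_sub_right_eq_self
          (fun t => ENNReal.ofReal (Real.exp (-(huberCost a t / v))))]
    _ ≤ ENNReal.ofReal K⁻¹ * ENNReal.ofReal K := by
        gcongr
        refine (lintegral_mono hcost).trans_eq ?_
        rw [lintegral_add_left (by fun_prop), lintegral_exp_neg_mul_sq (by positivity),
          lintegral_exp_neg_mul_abs (by positivity), ← ENNReal.ofReal_add (by positivity)
          (by positivity), div_inv_eq_mul, div_div_eq_mul_div]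
    _ = 1 := by
        rw [← ENNReal.ofReal_mul (by positivity), inv_mul_cancel₀ hKpos.ne', ENNReal.ofReal_one]

end RadialTest

section RingUpperBound

variable {a r : ℝ}

theorem huberCost_nonneg (ha : 0 ≤ a) (t : ℝ) : 0 ≤ huberCost a t :=
  le_min (sq_nonneg t) (mul_nonneg ha (abs_nonneg t))

theorem abs_norm_add_sub_le (hr : 0 ≤ r) (w : ℂ) : |‖(r : ℂ) + w‖ - r| ≤ ‖w‖ := by
  have h := abs_norm_sub_norm_le ((r : ℂ) + w) r
  rwa [add_sub_cancel_left, Complex.norm_of_nonneg hr] at h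

-- With `d = |r + w| - r`, expanding `|r + w|²` gives `2 r (d - Re w) = |w|² - d²`.
theorem sq_norm_add_sub_le (hr : 0 < r) (w : ℂ) :
    (‖(r : ℂ) + w‖ - r) ^ 2 ≤ w.re ^ 2 + ‖w‖ ^ 3 / r := by
  set d := ‖(r : ℂ) + w‖ - r with hd
  have habs : |d| ≤ ‖w‖ := abs_norm_add_sub_le hr.le w
  have hexpand : 2 * r * (d - w.re) = ‖w‖ ^ 2 - d ^ 2 := by
    have hsq : ‖(r : ℂ) + w‖ ^ 2 = r ^ 2 + 2 * r * w.re + ‖w‖ ^ 2 := by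
      rw [Complex.sq_norm, Complex.sq_norm, Complex.normSq_add, Complex.normSq_ofReal]
      simp
      ring
    rw [hd]
    linear_combination hsq
  have hdiff : 0 ≤ d - w.re := by
    have hsq_le : d ^ 2 ≤ ‖w‖ ^ 2 := sq_le_sq' (abs_le.1 habs).1 (abs_le.1 habs).2
    refine nonneg_of_mul_nonneg_right (?_ : 0 ≤ 2 * r * (d - w.re)) (by positivity)
    rwa [hexpand, sub_nonneg]
  have hdiff_le : d - w.re ≤ ‖w‖ ^ 2 / (2 * r) := by
    rw [le_div_iff₀ (by positivity), mul_comm, hexpand]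
    linarith [sq_nonneg d]
  have hsum : d + w.re ≤ 2 * ‖w‖ := by
    linarith [(abs_le.1 habs).2, Complex.re_le_norm w]
  calc d ^ 2 = w.re ^ 2 + (d - w.re) * (d + w.re) := by ring
    _ ≤ w.re ^ 2 + (d - w.re) * (2 * ‖w‖) := by gcongr
    _ ≤ w.re ^ 2 + ‖w‖ ^ 2 / (2 * r) * (2 * ‖w‖) := by gcongr
    _ = w.re ^ 2 + ‖w‖ ^ 3 / r := by field_simp

theorem huberCost_norm_add_sub_le (ha : 0 < a) (hr : 0 < r) (w : ℂ) :
    huberCost a (‖(r : ℂ) + w‖ - r) ≤ w.re ^ 2 + √(a / r) * ‖w‖ ^ 2 := by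
  have hsqrt : √(a / r) = √(a * r) / r := by
    rw [div_eq_mul_inv, Real.sqrt_mul ha.le, Real.sqrt_mul ha.le, Real.sqrt_inv, mul_div_assoc]
    congr 1
    rw [inv_eq_one_div, div_eq_div_iff (by positivity) hr.ne', one_mul, Real.mul_self_sqrt hr.le]
  rcases le_total ‖w‖ (√(a * r)) with hw | hw
  · calc huberCost a (‖(r : ℂ) + w‖ - r) ≤ w.re ^ 2 + ‖w‖ ^ 3 / r :=
          (min_le_left _ _).trans (sq_norm_add_sub_le hr w)
      _ = w.re ^ 2 + ‖w‖ / r * ‖w‖ ^ 2 := by ring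
      _ ≤ w.re ^ 2 + √(a / r) * ‖w‖ ^ 2 := by rw [hsqrt]; gcongr
  · calc huberCost a (‖(r : ℂ) + w‖ - r) ≤ a * ‖w‖ :=
          (min_le_right _ _).trans (by gcongr; exact abs_norm_add_sub_le hr.le w)
      _ = √(a * r) / r * ‖w‖ * √(a * r) := by
          rw [div_mul_eq_mul_div, div_mul_eq_mul_div, mul_right_comm, Real.mul_self_sqrt
            (by positivity)]
          field_simp
      _ ≤ √(a * r) / r * ‖w‖ * ‖w‖ := by gcongr
      _ ≤ w.re ^ 2 + √(a / r) * ‖w‖ ^ 2 := by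
          rw [hsqrt]
          linarith [sq_nonneg w.re]

end RingUpperBound

section CircleUpperBound

variable {a r c v : ℝ} {μ : Measure ℂ} [IsProbabilityMeasure μ]

theorem norm_circle_add (r θ : ℝ) (u : ℂ) :
    ‖r * Complex.exp (θ * Complex.I) + u‖ = ‖r + u * Complex.exp (-(θ * Complex.I))‖ := by
  have hrot : r * Complex.exp (θ * Complex.I) + u =
      (r + u * Complex.exp (-(θ * Complex.I))) * Complex.exp (θ * Complex.I) := by
    rw [add_mul, mul_assoc u, ← Complex.exp_add, neg_add_cancel, Complex.exp_zero, mul_one]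
  rw [hrot, norm_mul, Complex.norm_exp_ofReal_mul_I, mul_one]

theorem integrable_huberCost_norm_sub (ha : 0 ≤ a) (r : ℝ) (hμ : MemLp id 2 μ) :
    Integrable (fun y => huberCost a (‖y‖ - r)) μ := by
  refine (hμ.norm.sub (memLp_const r)).integrable_sq.mono' (by fun_prop)
    (Eventually.of_forall fun y => ?_)
  rw [Real.norm_of_nonneg (huberCost_nonneg ha _)]
  exact min_le_left _ _

theorem integral_huberCost_circleLaw_conv_le (ha : 0 < a) (hr : 0 < r) (hμ : MemLp id 2 μ) :
    ∫ y, huberCost a (‖y‖ - r) ∂(circleLaw r ∗ μ) ≤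
      (1 / 2 + √(a / r)) * ∫ u, ‖u‖ ^ 2 ∂μ := by
  have hint := integrable_huberCost_norm_sub ha.le r (memLp_id_conv (memLp_id_circleLaw r 2) hμ)
  rw [Measure.conv_comm] at hint ⊢
  rw [integral_conv hint, ← integral_const_mul]
  refine integral_mono_of_nonneg
    (Eventually.of_forall fun u => integral_nonneg fun x => huberCost_nonneg ha.le _)
    ((integrable_norm_sq_of_memLp hμ).const_mul _) (Eventually.of_forall fun u => ?_)
  have hrot : Integrable (fun θ : ℝ => (u * Complex.exp (-(θ * Complex.I))).re ^ 2)
      uniformPhase := by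
    refine (integrable_const (‖u‖ ^ 2)).mono' (by fun_prop) (Eventually.of_forall fun θ => ?_)
    rw [Real.norm_of_nonneg (sq_nonneg _), ← sq_abs]
    gcongr
    refine (Complex.abs_re_le_norm _).trans_eq ?_
    simp [Complex.norm_exp]
  calc ∫ x, huberCost a (‖u + x‖ - r) ∂circleLaw r
      = ∫ θ : ℝ, huberCost a (‖r + u * Complex.exp (-(θ * Complex.I))‖ - r) ∂uniformPhase := by
        rw [circleLaw, integral_map (by fun_prop) (by fun_prop)]
        simp only [add_comm u, norm_circle_add]
    _ ≤ ∫ θ : ℝ, ((u * Complex.exp (-(θ * Complex.I))).re ^ 2 + √(a / r) * ‖u‖ ^ 2)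
          ∂uniformPhase := by
        refine integral_mono_of_nonneg (Eventually.of_forall fun θ => huberCost_nonneg ha.le _)
          (hrot.add (integrable_const _)) (Eventually.of_forall fun θ => ?_)
        refine (huberCost_norm_add_sub_le ha hr _).trans_eq ?_
        simp [Complex.norm_exp]
    _ = (1 / 2 + √(a / r)) * ‖u‖ ^ 2 := by
        rw [integral_add hrot (integrable_const _), integral_re_rotate_sq_uniformPhase,
          integral_const, probReal_univ, one_smul]
        ring

/-- The test surprisal used against `r e^{jΘ} + U` when `E|U|² ≤ v`. The scale `√r` of the Huber
cost tends to infinity, yet slower than `r`. -/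
def ringTest (v r : ℝ) : ℂ → ℝ :=
  radialTest (r ^ 2 + v) (huberSurprisal v (√r) r)

/-- The resulting upper bound on the expectation of `ringTest v r`. -/
def ringBound (v r : ℝ) : ℝ :=
  Real.log (2 * Real.pi) + Real.log (r ^ 2 + v) / 2 + Real.log (√(Real.pi * v) + 2 * v / √r) +
    (1 / 2 + √(√r / r))

theorem measurable_ringTest (v r : ℝ) : Measurable (ringTest v r) :=
  measurable_radialTest (continuous_huberSurprisal v (√r) r).measurable

theorem lintegral_exp_neg_ringTest_le_one (hv : 0 < v) (hr : 0 < r) :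
    ∫⁻ y, ENNReal.ofReal (Real.exp (-ringTest v r y)) ≤ 1 :=
  lintegral_exp_neg_radialTest_le_one (by positivity)
    (continuous_huberSurprisal v (√r) r).measurable
    (lintegral_exp_neg_huberSurprisal_le_one hv (Real.sqrt_pos.2 hr) r)

theorem integrable_ringTest (v r : ℝ) (hμ : MemLp id 2 μ) : Integrable (ringTest v r) μ :=
  ((integrable_const _).add ((((integrable_const _).add
    ((integrable_norm_sq_of_memLp hμ).div_const _)).sub (integrable_const 1)).div_const 2)).add
    ((integrable_const _).add
      ((integrable_huberCost_norm_sub (Real.sqrt_nonneg r) r hμ).div_const v))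

theorem integral_ringTest_le (hv : 0 < v) (hr : 0 < r) (hμ : MemLp id 2 μ)
    (hle : ∫ u, ‖u‖ ^ 2 ∂μ ≤ v) : ∫ y, ringTest v r y ∂(circleLaw r ∗ μ) ≤ ringBound v r := by
  have hmem := memLp_id_conv (memLp_id_circleLaw r 2) hμ
  have hsq := integrable_norm_sq_of_memLp hmem
  have hhuber := integrable_huberCost_norm_sub (Real.sqrt_nonneg r) r hmem
  have hpower : (∫ y, ‖y‖ ^ 2 ∂(circleLaw r ∗ μ)) / (r ^ 2 + v) ≤ 1 := by
    rw [Measure.conv_comm, integral_norm_sq_conv hμ (memLp_id_circleLaw r 2) integral_id_circleLaw,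
      integral_norm_sq_circleLaw, div_le_one (by positivity)]
    linarith
  have hcost : (∫ y, huberCost (√r) (‖y‖ - r) ∂(circleLaw r ∗ μ)) / v ≤ 1 / 2 + √(√r / r) := by
    rw [div_le_iff₀ hv]
    refine (integral_huberCost_circleLaw_conv_le (Real.sqrt_pos.2 hr) hr hμ).trans ?_
    gcongr
  have hexpect : ∫ y, ringTest v r y ∂(circleLaw r ∗ μ) =
      Real.log (2 * Real.pi) +
        (Real.log (r ^ 2 + v) + (∫ y, ‖y‖ ^ 2 ∂(circleLaw r ∗ μ)) / (r ^ 2 + v) - 1) / 2 +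
        (Real.log (√(Real.pi * v) + 2 * v / √r) +
          (∫ y, huberCost (√r) (‖y‖ - r) ∂(circleLaw r ∗ μ)) / v) := by
    simp only [ringTest, radialTest, huberSurprisal]
    rw [integral_add (by fun_prop) (by fun_prop), integral_add (by fun_prop) (by fun_prop),
      integral_add (by fun_prop) (by fun_prop), integral_div, integral_div,
      integral_sub (by fun_prop) (by fun_prop), integral_add (by fun_prop) (by fun_prop),
      integral_div]
    simp
  rw [hexpect, ringBound]
  linarith

end CircleUpperBound

section PosteriorTest

variable {α G : Type*} [MeasurableSpace α] [MeasureSpace G] [AddGroup G] [MeasurableAdd₂ G]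
  [SigmaFinite (volume : Measure G)] [(volume : Measure G).IsAddLeftInvariant]
  {F : Measure α} [IsProbabilityMeasure F] {N : Measure G} [IsProbabilityMeasure N]
  {s : α → G} {A B : G → ℝ}

theorem HasSurprisal.lintegral_exp_sub_mul_le_one (hs : Measurable s) (hN : HasSurprisal N A)
    (hB : HasSurprisal (F.map s ∗ N) B) {q : α × G → ℝ≥0∞} (hq : Measurable q)
    (hq_le : ∀ᵐ y, ∫⁻ x, q (x, y) ∂F ≤ 1) :
    ∫⁻ p, ENNReal.ofReal (Real.exp (A p.2 - B (s p.1 + p.2))) * q (p.1, s p.1 + p.2)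
      ∂(F.prod N) ≤ 1 := by
  have hA_meas := hN.measurable
  have hB_meas := hB.measurable
  have := Measure.isProbabilityMeasure_map (μ := F) hs.aemeasurable
  have hcancel (x : α) (w : G) : ENNReal.ofReal (Real.exp (-A w)) *
      (ENNReal.ofReal (Real.exp (A w - B (s x + w))) * q (x, s x + w)) =
        ENNReal.ofReal (Real.exp (-B (s x + w))) * q (x, s x + w) := by
    rw [← mul_assoc, ← ENNReal.ofReal_mul (Real.exp_nonneg _), ← Real.exp_add]
    ring_nf
  calc _ = ∫⁻ x, ∫⁻ y, ENNReal.ofReal (Real.exp (-B y)) * q (x, y) ∂volume ∂F := by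
        rw [lintegral_prod _ (by fun_prop)]
        refine lintegral_congr fun x => ?_
        rw [hN.lintegral_eq (by fun_prop)]
        simp only [hcancel]
        exact lintegral_add_left_eq_self
          (fun y => ENNReal.ofReal (Real.exp (-B y)) * q (x, y)) (s x)
    _ = ∫⁻ y, ENNReal.ofReal (Real.exp (-B y)) * ∫⁻ x, q (x, y) ∂F := by
        rw [lintegral_lintegral_swap (by fun_prop)]
        exact lintegral_congr fun y => lintegral_const_mul _ (by fun_prop)
    _ ≤ ∫⁻ y, ENNReal.ofReal (Real.exp (-B y)) * 1 :=
        lintegral_mono_ae (hq_le.mono fun y hy => mul_le_mul_right hy _)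
    _ = 1 := by simp only [mul_one, hB.lintegral_exp_neg_eq_one]

-- The Barber–Agakov bound `I(X; Y) ≥ E[log (q(X|Y) / p(X))]`, with `ℓ = log (q / p)`.
theorem HasSurprisal.add_integral_le_differentialEntropy_conv (hs : Measurable s)
    (hN : HasSurprisal N A) (hB : HasSurprisal (F.map s ∗ N) B) {ℓ : α × G → ℝ}
    (hℓ : Measurable ℓ) (hint : Integrable (fun p => ℓ (p.1, s p.1 + p.2)) (F.prod N))
    (hexp : ∀ᵐ y, ∫⁻ x, ENNReal.ofReal (Real.exp (ℓ (x, y))) ∂F ≤ 1) :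
    differentialEntropy N + ∫ p, ℓ (p.1, s p.1 + p.2) ∂(F.prod N) ≤
      differentialEntropy (F.map s ∗ N) := by
  have := Measure.isProbabilityMeasure_map (μ := F) hs.aemeasurable
  have hout : MeasurePreserving (fun p : α × G => s p.1 + p.2) (F.prod N) (F.map s ∗ N) := by
    refine ⟨by fun_prop, ?_⟩
    conv_rhs => rw [Measure.conv, ← Measure.map_id (μ := N),
      Measure.map_prod_map _ _ hs measurable_id, Measure.map_map (by fun_prop) (by fun_prop)]
    rfl
  have hA_int : Integrable (fun p : α × G => A p.2) (F.prod N) := hN.integrable.comp_snd F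
  have hB_int : Integrable (fun p : α × G => B (s p.1 + p.2)) (F.prod N) :=
    (hout.integrable_comp hB.integrable.1).2 hB.integrable
  have hsub_int : Integrable (fun p : α × G => B (s p.1 + p.2) - A p.2) (F.prod N) :=
    hB_int.sub hA_int
  have hA_eq : ∫ p, A p.2 ∂(F.prod N) = differentialEntropy N := by
    rw [hN.differentialEntropy_eq, integral_fun_snd, probReal_univ, one_smul]
  have hB_eq : ∫ p, B (s p.1 + p.2) ∂(F.prod N) = differentialEntropy (F.map s ∗ N) := by
    rw [hB.differentialEntropy_eq, ← hout.map_eq,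
      integral_map hout.aemeasurable hB.measurable.aestronglyMeasurable]
  have hnonneg := integral_nonneg_of_lintegral_exp_neg_le_one
    (f := fun p : α × G => B (s p.1 + p.2) - A p.2 - ℓ (p.1, s p.1 + p.2))
    (hsub_int.sub hint) (by
      refine Eq.trans_le (lintegral_congr fun p => ?_) (hN.lintegral_exp_sub_mul_le_one hs hB
        (q := fun p => ENNReal.ofReal (Real.exp (ℓ p))) (by fun_prop) hexp)
      rw [← ENNReal.ofReal_mul (Real.exp_nonneg _), ← Real.exp_add]
      ring_nf)
  rw [integral_sub hsub_int hint, integral_sub hB_int hA_int, hA_eq, hB_eq] at hnonneg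
  linarith

end PosteriorTest

section PhaseEstimate

theorem integral_comp_arg_rotate_uniformPhase {E : Type*} [NormedAddCommGroup E]
    [NormedSpace ℝ E] (g : ℝ → E) {y : ℂ} (hy : y ≠ 0) :
    ∫ θ : ℝ, g (y * Complex.exp (-(θ * Complex.I))).arg ∂uniformPhase =
      (2 * Real.pi)⁻¹ • ∫ t in -Real.pi..Real.pi, g t := by
  have hperiodic : Function.Periodic
      (fun θ : ℝ => g (y * Complex.exp (-(θ * Complex.I))).arg) (2 * Real.pi) := by
    intro θ
    have hexp : Complex.exp (-(((θ + 2 * Real.pi : ℝ) : ℂ) * Complex.I)) =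
        Complex.exp (-(θ * Complex.I)) :=
      Complex.exp_eq_exp_iff_exists_int.2 ⟨-1, by push_cast; ring⟩
    simp only [hexp]
  have hrot {t : ℝ} (ht : t ∈ Set.Ioc (-Real.pi) Real.pi) :
      (y * Complex.exp (-((y.arg - t : ℝ) * Complex.I))).arg = t := by
    have hpolar : y * Complex.exp (-((y.arg - t : ℝ) * Complex.I)) =
        ‖y‖ * Complex.exp (t * Complex.I) := by
      nth_rw 1 [← Complex.norm_mul_exp_arg_mul_I y]
      rw [mul_assoc, ← Complex.exp_add]
      push_cast
      ring_nf
    rw [hpolar, Complex.exp_mul_I, Complex.arg_mul_cos_add_sin_mul_I (norm_pos_iff.2 hy) ht]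
  rw [integral_uniformPhase]
  congr 1
  calc ∫ θ in (0 : ℝ)..2 * Real.pi, g (y * Complex.exp (-(θ * Complex.I))).arg
      = ∫ θ in y.arg - Real.pi..y.arg - -Real.pi, g (y * Complex.exp (-(θ * Complex.I))).arg := by
        have h := hperiodic.intervalIntegral_add_eq 0 (y.arg - Real.pi)
        rwa [zero_add, show y.arg - Real.pi + 2 * Real.pi = y.arg - -Real.pi by ring] at h
    _ = ∫ t in -Real.pi..Real.pi, g (y * Complex.exp (-((y.arg - t : ℝ) * Complex.I))).arg :=
        (intervalIntegral.integral_comp_sub_left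
          (fun θ : ℝ => g (y * Complex.exp (-(θ * Complex.I))).arg) y.arg).symm
    _ = ∫ t in -Real.pi..Real.pi, g t := by
        rw [intervalIntegral.integral_of_le (by linarith [Real.pi_pos]),
          intervalIntegral.integral_of_le (by linarith [Real.pi_pos])]
        exact setIntegral_congr_fun measurableSet_Ioc fun t ht => by simp only [hrot ht]

variable {κ : ℝ}

/-- The logarithm of the likelihood ratio `q(θ | y) / p(θ)`, where `p` is the uniform density
on `[0, 2π]` and `q(· | y)` is a Gaussian density of variance `1 / κ` about the phase of `y`. -/
def phaseLogRatio (κ : ℝ) (p : ℝ × ℂ) : ℝ :=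
  Real.log (2 * Real.pi * κ) / 2 - κ / 2 * (p.2 * Complex.exp (-(p.1 * Complex.I))).arg ^ 2

theorem measurable_phaseLogRatio (κ : ℝ) : Measurable (phaseLogRatio κ) := by
  have : Measurable fun p : ℝ × ℂ => (p.2 * Complex.exp (-(p.1 * Complex.I))).arg :=
    Complex.measurable_arg.comp (by fun_prop)
  unfold phaseLogRatio
  fun_prop

theorem lintegral_exp_phaseLogRatio_le_one (hκ : 0 < κ) {y : ℂ} (hy : y ≠ 0) :
    ∫⁻ θ, ENNReal.ofReal (Real.exp (phaseLogRatio κ (θ, y))) ∂uniformPhase ≤ 1 := by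
  have hmeas : Measurable fun θ => phaseLogRatio κ (θ, y) :=
    (measurable_phaseLogRatio κ).comp (by fun_prop)
  have hbdd (θ : ℝ) : phaseLogRatio κ (θ, y) ≤ Real.log (2 * Real.pi * κ) / 2 :=
    sub_le_self _ (by positivity)
  have hint : Integrable (fun θ => Real.exp (phaseLogRatio κ (θ, y))) uniformPhase :=
    (integrable_const (Real.exp (Real.log (2 * Real.pi * κ) / 2))).mono'
      hmeas.exp.aestronglyMeasurable (Eventually.of_forall fun θ => by
        rw [Real.norm_eq_abs, Real.abs_exp]
        exact Real.exp_le_exp.2 (hbdd θ))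
  rw [← ofReal_integral_eq_lintegral_ofReal hint (Eventually.of_forall fun θ => Real.exp_nonneg _),
    ENNReal.ofReal_le_one]
  have hsqrt : Real.exp (Real.log (2 * Real.pi * κ) / 2) = √(2 * Real.pi * κ) := by
    rw [Real.exp_half, Real.exp_log (by positivity)]
  calc ∫ θ, Real.exp (phaseLogRatio κ (θ, y)) ∂uniformPhase
      = (2 * Real.pi)⁻¹ *
          (√(2 * Real.pi * κ) * ∫ t in -Real.pi..Real.pi, Real.exp (-(κ / 2) * t ^ 2)) := by
        have h := integral_comp_arg_rotate_uniformPhase (fun t => Real.exp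
          (Real.log (2 * Real.pi * κ) / 2 - κ / 2 * t ^ 2)) hy
        simp only [sub_eq_add_neg, ← neg_mul, Real.exp_add, hsqrt,
          intervalIntegral.integral_const_mul, smul_eq_mul] at h
        simpa only [phaseLogRatio, sub_eq_add_neg, ← neg_mul, Real.exp_add, hsqrt] using h
    _ ≤ (2 * Real.pi)⁻¹ * (√(2 * Real.pi * κ) * √(Real.pi / (κ / 2))) := by
        rw [← integral_gaussian, intervalIntegral.integral_of_le (by linarith [Real.pi_pos])]
        gcongr ?_ * (?_ * ?_)
        exact setIntegral_le_integral (integrable_exp_neg_mul_sq (by positivity))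
          (Eventually.of_forall fun t => Real.exp_nonneg _)
    _ = 1 := by
        rw [← Real.sqrt_mul (by positivity),
          show 2 * Real.pi * κ * (Real.pi / (κ / 2)) = (2 * Real.pi) ^ 2 by field_simp,
          Real.sqrt_sq (by positivity), inv_mul_cancel₀ (by positivity)]

/-- The phase of `r e^{jθ} + z` relative to `θ`: the error made when the phase `θ` of the
interference is estimated by the phase of the observation. -/
def phaseError (r : ℝ) (p : ℝ × ℂ) : ℝ :=
  (r + p.2 * Complex.exp (-(p.1 * Complex.I))).arg

@[fun_prop]
theorem measurable_phaseError (r : ℝ) : Measurable (phaseError r) :=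
  Complex.measurable_arg.comp (by fun_prop)

theorem phaseLogRatio_circle_add (κ r : ℝ) (p : ℝ × ℂ) :
    phaseLogRatio κ (p.1, r * Complex.exp (p.1 * Complex.I) + p.2) =
      Real.log (2 * Real.pi * κ) / 2 - κ / 2 * phaseError r p ^ 2 := by
  have hrot : (r * Complex.exp (p.1 * Complex.I) + p.2) * Complex.exp (-(p.1 * Complex.I)) =
      r + p.2 * Complex.exp (-(p.1 * Complex.I)) := by
    rw [add_mul, mul_assoc, ← Complex.exp_add, add_neg_cancel, Complex.exp_zero, mul_one]
  rw [phaseLogRatio, hrot, phaseError]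

variable {N : Measure ℂ} [IsProbabilityMeasure N] {A B : ℂ → ℝ}

theorem HasSurprisal.le_differentialEntropy_circleLaw_conv {r : ℝ} (hN : HasSurprisal N A)
    (hB : HasSurprisal (circleLaw r ∗ N) B) (hκ : 0 < κ) :
    differentialEntropy N + (Real.log (2 * Real.pi * κ) / 2 -
        κ / 2 * ∫ p, phaseError r p ^ 2 ∂(uniformPhase.prod N)) ≤
      differentialEntropy (circleLaw r ∗ N) := by
  have hsq : Integrable (fun p => phaseError r p ^ 2) (uniformPhase.prod N) :=
    (integrable_const (Real.pi ^ 2)).mono' (by fun_prop) (Eventually.of_forall fun p => by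
      rw [Real.norm_of_nonneg (sq_nonneg _), ← sq_abs]
      gcongr
      exact Complex.abs_arg_le_pi _)
  have hint : Integrable (fun p : ℝ × ℂ =>
      phaseLogRatio κ (p.1, r * Complex.exp (p.1 * Complex.I) + p.2)) (uniformPhase.prod N) := by
    simp only [phaseLogRatio_circle_add]
    exact (integrable_const _).sub (hsq.const_mul _)
  have h := hN.add_integral_le_differentialEntropy_conv (by fun_prop) hB
    (measurable_phaseLogRatio κ) hint ((Measure.ae_ne volume 0).mono fun y hy =>
      lintegral_exp_phaseLogRatio_le_one hκ hy)
  simp only [phaseLogRatio_circle_add] at h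
  rwa [integral_sub (integrable_const _) (hsq.const_mul _), integral_const, probReal_univ,
    one_smul, integral_const_mul] at h

theorem abs_arg_one_add_le (w : ℂ) : |(1 + w).arg| ≤ 2 * Real.pi * ‖w‖ := by
  rcases le_total ‖w‖ (1 / 2) with hw | hw
  · calc |(1 + w).arg| ≤ ‖Complex.log (1 + w)‖ :=
        Complex.log_im (1 + w) ▸ Complex.abs_im_le_norm _
      _ ≤ 3 / 2 * ‖w‖ := Complex.norm_log_one_add_half_le_self hw
      _ ≤ 2 * Real.pi * ‖w‖ := by
        gcongr
        linarith [Real.pi_gt_three]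
  · calc |(1 + w).arg| ≤ 2 * Real.pi * (1 / 2) := (Complex.abs_arg_le_pi _).trans_eq (by ring)
      _ ≤ 2 * Real.pi * ‖w‖ := by gcongr

theorem arg_ofReal_add {r : ℝ} (hr : 0 < r) (w : ℂ) : (r + w).arg = (1 + w / r).arg := by
  rw [← Complex.arg_real_mul (1 + w / r) hr, mul_add, mul_one,
    mul_div_cancel₀ _ (Complex.ofReal_ne_zero.2 hr.ne')]

theorem abs_mul_arg_ofReal_add_le {r : ℝ} (hr : 0 < r) (w : ℂ) :
    |r * (r + w).arg| ≤ 2 * Real.pi * ‖w‖ := by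
  rw [abs_mul, abs_of_pos hr, arg_ofReal_add hr]
  calc r * |(1 + w / r).arg| ≤ r * (2 * Real.pi * ‖w / r‖) := by
        gcongr
        exact abs_arg_one_add_le _
    _ = 2 * Real.pi * ‖w‖ := by
        rw [norm_div, Complex.norm_of_nonneg hr.le]
        field_simp

theorem tendsto_mul_arg_ofReal_add (w : ℂ) :
    Tendsto (fun r : ℝ => r * (r + w).arg) atTop (𝓝 w.im) := by
  have hlin : Tendsto (fun r : ℝ => (r : ℂ) * (w / r)) atTop (𝓝 w) :=
    tendsto_const_nhds.congr' ((eventually_ne_atTop 0).mono fun r hr =>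
      (mul_div_cancel₀ _ (Complex.ofReal_ne_zero.2 hr)).symm)
  have him := (Complex.continuous_im.tendsto _).comp
    (Complex.tendsto_mul_log_one_add_of_tendsto hlin)
  refine him.congr' ((eventually_gt_atTop 0).mono fun r hr => ?_)
  simp [arg_ofReal_add hr, Complex.log_im]

theorem tendsto_integral_mul_phaseError_sq (hN : MemLp id 2 N) :
    Tendsto (fun r => ∫ p, (r * phaseError r p) ^ 2 ∂(uniformPhase.prod N)) atTop
      (𝓝 ((∫ z, ‖z‖ ^ 2 ∂N) / 2)) := by
  have hnorm (p : ℝ × ℂ) : ‖p.2 * Complex.exp (-(p.1 * Complex.I))‖ = ‖p.2‖ := by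
    simp [Complex.norm_exp]
  have hdom : Integrable (fun p : ℝ × ℂ => (2 * Real.pi) ^ 2 * ‖p.2‖ ^ 2)
      (uniformPhase.prod N) := ((integrable_norm_sq_of_memLp hN).comp_snd _).const_mul _
  have him : Integrable (fun p : ℝ × ℂ => (p.2 * Complex.exp (-(p.1 * Complex.I))).im ^ 2)
      (uniformPhase.prod N) := by
    refine ((integrable_norm_sq_of_memLp hN).comp_snd _).mono' (by fun_prop)
      (Eventually.of_forall fun p => ?_)
    rw [Real.norm_of_nonneg (sq_nonneg _), ← sq_abs, ← hnorm p]
    gcongr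
    exact Complex.abs_im_le_norm _
  have hlimit : ∫ p : ℝ × ℂ, (p.2 * Complex.exp (-(p.1 * Complex.I))).im ^ 2
      ∂(uniformPhase.prod N) = (∫ z, ‖z‖ ^ 2 ∂N) / 2 := by
    rw [integral_prod_symm _ him, ← integral_div]
    simp only [integral_im_rotate_sq_uniformPhase]
  rw [← hlimit]
  refine tendsto_integral_filter_of_dominated_convergence _
    (Eventually.of_forall fun r => by fun_prop) ?_ hdom
    (Eventually.of_forall fun p => (tendsto_mul_arg_ofReal_add _).pow 2)
  filter_upwards [eventually_gt_atTop 0] with r hr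
  refine Eventually.of_forall fun p => ?_
  rw [Real.norm_of_nonneg (sq_nonneg _), ← sq_abs, ← mul_pow, ← hnorm p]
  gcongr
  exact abs_mul_arg_ofReal_add_le hr _

end PhaseEstimate

section AdmissibleInput

variable {S : ℝ≥0} {F : Measure ℂ}

theorem IsAdmissibleInput.memLp_id (hF : IsAdmissibleInput S F) : MemLp id 2 F := by
  refine (memLp_two_iff_integrable_sq_norm (by fun_prop)).2 ⟨by fun_prop, ?_⟩
  refine lt_of_eq_of_lt (lintegral_congr fun x => ?_) (hF.2.trans_lt ENNReal.coe_lt_top)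
  simp only [id_eq, enorm_pow, enorm_norm]

theorem IsAdmissibleInput.integral_norm_sq_le (hF : IsAdmissibleInput S F) :
    ∫ x, ‖x‖ ^ 2 ∂F ≤ S := by
  rw [← ENNReal.ofReal_le_ofReal_iff S.coe_nonneg, ENNReal.ofReal_coe_nnreal,
    ofReal_integral_eq_lintegral_ofReal (integrable_norm_sq_of_memLp hF.memLp_id)
      (Eventually.of_forall fun x => by positivity)]
  refine (lintegral_congr fun x => ?_).trans_le hF.2
  rw [ENNReal.ofReal_pow (norm_nonneg _), ofReal_norm]

theorem IsAdmissibleInput.integral_norm_sq_conv_complexGaussian_le (hF : IsAdmissibleInput S F) :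
    ∫ y, ‖y‖ ^ 2 ∂(F ∗ complexGaussian 1) ≤ S + 1 := by
  have := hF.1
  rw [integral_norm_sq_conv hF.memLp_id memLp_id_complexGaussian integral_id_complexGaussian,
    integral_norm_sq_complexGaussian, NNReal.coe_one]
  exact add_le_add_left hF.integral_norm_sq_le 1

end AdmissibleInput

section RingEntropy

variable {v : ℝ≥0} {r : ℝ}

theorem differentialEntropy_ringLaw_le (hv : v ≠ 0) (hr : 0 < r) :
    differentialEntropy (ringLaw v r) ≤ ringBound v r := by
  have hv0 : (0 : ℝ) < v := by positivity
  obtain ⟨B, hB⟩ := exists_hasSurprisal_ringLaw hv r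
  refine (hB.differentialEntropy_le (measurable_ringTest v r)
    (integrable_ringTest v r (memLp_id_ringLaw v r))
    (lintegral_exp_neg_ringTest_le_one hv0 hr)).trans ?_
  exact integral_ringTest_le hv0 hr memLp_id_complexGaussian integral_norm_sq_complexGaussian.le

theorem le_differentialEntropy_ringLaw (hv : v ≠ 0) (hr : 0 < r) :
    Real.log (Real.pi * v) + 1 + Real.log (4 * Real.pi * r ^ 2 / v) / 2 -
        (∫ p, (r * phaseError r p) ^ 2 ∂(uniformPhase.prod (complexGaussian v))) / v ≤
      differentialEntropy (ringLaw v r) := by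
  have : (0 : ℝ) < v := by positivity
  obtain ⟨B, hB⟩ := exists_hasSurprisal_ringLaw hv r
  have h := (hasSurprisal_complexGaussian hv).le_differentialEntropy_circleLaw_conv hB
    (κ := 2 * r ^ 2 / v) (by positivity)
  rw [differentialEntropy_complexGaussian hv] at h
  simp only [mul_pow, integral_const_mul]
  convert h using 1
  · ring_nf
  · rfl

theorem tendsto_ringBound_sub_log {v : ℝ} (hv : 0 < v) :
    Tendsto (fun r => ringBound v r - Real.log r) atTop
      (𝓝 (Real.log (2 * Real.pi) + Real.log (Real.pi * v) / 2 + 1 / 2)) := by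
  have hsqrt : Tendsto (fun r : ℝ => (√r)⁻¹) atTop (𝓝 0) :=
    tendsto_inv_atTop_zero.comp Real.tendsto_sqrt_atTop
  have hpower : Tendsto (fun r : ℝ => Real.log (1 + v * ((√r)⁻¹ ^ 2) ^ 2) / 2) atTop (𝓝 0) := by
    have h := ((((hsqrt.pow 2).pow 2).const_mul v).const_add 1).log (by norm_num)
    simpa using h.div_const 2
  have hnorm : Tendsto (fun r : ℝ => Real.log (√(Real.pi * v) + 2 * v * (√r)⁻¹)) atTop
      (𝓝 (Real.log (Real.pi * v) / 2)) := by
    have h := ((hsqrt.const_mul (2 * v)).const_add (√(Real.pi * v))).log (by positivity)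
    rwa [mul_zero, add_zero, Real.log_sqrt (by positivity)] at h
  have hcost : Tendsto (fun r : ℝ => 1 / 2 + √((√r)⁻¹)) atTop (𝓝 (1 / 2)) := by
    simpa only [Real.sqrt_zero, add_zero] using hsqrt.sqrt.const_add (1 / 2)
  have hsum := ((hpower.const_add (Real.log (2 * Real.pi))).add hnorm).add hcost
  rw [add_zero] at hsum
  refine hsum.congr' ((eventually_gt_atTop 0).mono fun r hr => ?_)
  have hlog : Real.log (r ^ 2 + v) / 2 - Real.log r = Real.log (1 + v * ((√r)⁻¹ ^ 2) ^ 2) / 2 := by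
    have hsplit : r ^ 2 + v = r ^ 2 * (1 + v * ((√r)⁻¹ ^ 2) ^ 2) := by
      rw [inv_pow, Real.sq_sqrt hr.le]
      field_simp
    rw [hsplit, Real.log_mul (by positivity) (by positivity), Real.log_pow]
    push_cast
    ring
  simp only [ringBound]
  rw [← hlog, Real.sqrt_div_self', one_div (√r), div_eq_mul_inv (2 * v)]
  ring

theorem tendsto_differentialEntropy_ringLaw_sub_log (hv : v ≠ 0) :
    Tendsto (fun r => differentialEntropy (ringLaw v r) - Real.log r) atTop
      (𝓝 (Real.log (2 * Real.pi) + Real.log (Real.pi * v) / 2 + 1 / 2)) := by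
  have hv0 : (0 : ℝ) < v := by positivity
  have hlower := ((tendsto_integral_mul_phaseError_sq
    (memLp_id_complexGaussian (v := v))).div_const (v : ℝ)).const_sub
      (Real.log (Real.pi * v) + 1 + Real.log (4 * Real.pi / v) / 2)
  have hconst : Real.log (Real.pi * v) + 1 + Real.log (4 * Real.pi / v) / 2 -
      (∫ z, ‖z‖ ^ 2 ∂complexGaussian v) / 2 / v =
        Real.log (2 * Real.pi) + Real.log (Real.pi * v) / 2 + 1 / 2 := by
    have hsplit : 4 * Real.pi / v = (2 * Real.pi) ^ 2 / (Real.pi * v) := by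
      field_simp
      ring
    rw [hsplit, Real.log_div (by positivity) (by positivity), Real.log_pow,
      integral_norm_sq_complexGaussian, div_right_comm, div_self hv0.ne']
    push_cast
    ring
  rw [hconst] at hlower
  refine tendsto_of_tendsto_of_tendsto_of_le_of_le' hlower (tendsto_ringBound_sub_log hv0) ?_
    ((eventually_gt_atTop 0).mono fun r hr =>
      sub_le_sub_right (differentialEntropy_ringLaw_le hv hr) _)
  filter_upwards [eventually_gt_atTop 0] with r hr
  have h := le_differentialEntropy_ringLaw hv hr
  rw [mul_div_right_comm, Real.log_mul (x := 4 * Real.pi / v) (by positivity) (by positivity),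
    Real.log_pow] at h
  push_cast at h
  linarith

end RingEntropy

section Capacity

variable {S : ℝ≥0}

theorem inputOutputInformation_complexGaussian (S : ℝ≥0) (inr : ℝ) :
    inputOutputInformation (complexGaussian S) inr = ENNReal.ofReal
      (differentialEntropy (ringLaw (S + 1) (√inr)) - differentialEntropy (ringLaw 1 (√inr))) := by
  obtain ⟨B, hB⟩ := exists_hasSurprisal_ringLaw one_ne_zero (√inr)
  obtain ⟨A, hA⟩ := exists_hasSurprisal_ringLaw (v := S + 1) (by positivity) (√inr)
  rw [← complexGaussian_conv_ringLaw] at hA ⊢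
  rw [inputOutputInformation, inputOutputLaw_eq_additiveNoiseLaw,
    hB.mutualInformation_additiveNoiseLaw hA]

theorem capacity_le {inr : ℝ} (hinr : 0 < inr) :
    capacity S inr ≤ ENNReal.ofReal
      (ringBound (S + 1) (√inr) - differentialEntropy (ringLaw 1 (√inr))) := by
  refine iSup₂_le fun F hF => ?_
  have := hF.1
  have hS : (0 : ℝ) < S + 1 := by positivity
  have hr : 0 < √inr := Real.sqrt_pos.2 hinr
  obtain ⟨B, hB⟩ := exists_hasSurprisal_ringLaw one_ne_zero (√inr)
  have hinfo := hB.mutualInformation_additiveNoiseLaw_le (F := F)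
    (measurable_ringTest (S + 1) (√inr))
    (integrable_ringTest _ _ (memLp_id_conv hF.memLp_id (memLp_id_ringLaw 1 (√inr))))
    (lintegral_exp_neg_ringTest_le_one hS hr)
  rw [inputOutputInformation, inputOutputLaw_eq_additiveNoiseLaw]
  refine hinfo.trans (ENNReal.ofReal_le_ofReal (sub_le_sub_right ?_ _))
  rw [conv_ringLaw]
  exact integral_ringTest_le hS hr (memLp_id_conv hF.memLp_id memLp_id_complexGaussian)
    hF.integral_norm_sq_conv_complexGaussian_le

theorem half_log_one_add_eq_sub (S : ℝ≥0) :
    1 / 2 * Real.log (1 + S) =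
      Real.log (2 * Real.pi) + Real.log (Real.pi * (S + 1 : ℝ≥0)) / 2 + 1 / 2 -
        (Real.log (2 * Real.pi) + Real.log (Real.pi * (1 : ℝ≥0)) / 2 + 1 / 2) := by
  rw [NNReal.coe_add, NNReal.coe_one, mul_one, Real.log_mul Real.pi_ne_zero (by positivity),
    add_comm (S : ℝ)]
  ring

theorem tendsto_inputOutputInformation_complexGaussian (S : ℝ≥0) :
    Tendsto (fun inr : ℝ => inputOutputInformation (complexGaussian S) inr) atTop
      (𝓝 (ENNReal.ofReal (1 / 2 * Real.log (1 + (S : ℝ))))) := by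
  simp only [inputOutputInformation_complexGaussian]
  refine ENNReal.tendsto_ofReal ?_
  have h := ((tendsto_differentialEntropy_ringLaw_sub_log (v := S + 1) (by positivity)).sub
    (tendsto_differentialEntropy_ringLaw_sub_log one_ne_zero)).comp Real.tendsto_sqrt_atTop
  rw [half_log_one_add_eq_sub]
  simpa only [Function.comp_def, sub_sub_sub_cancel_right] using h

theorem tendsto_capacity (S : ℝ≥0) :
    Tendsto (fun inr : ℝ => capacity S inr) atTop
      (𝓝 (ENNReal.ofReal (1 / 2 * Real.log (1 + (S : ℝ))))) := by
  have hS : (0 : ℝ) < (S + 1 : ℝ≥0) := by positivity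
  have hupper := ((tendsto_ringBound_sub_log hS).sub
    (tendsto_differentialEntropy_ringLaw_sub_log one_ne_zero)).comp Real.tendsto_sqrt_atTop
  rw [← half_log_one_add_eq_sub] at hupper
  simp only [Function.comp_def, sub_sub_sub_cancel_right] at hupper
  exact tendsto_of_tendsto_of_tendsto_of_le_of_le'
    (tendsto_inputOutputInformation_complexGaussian S) (ENNReal.tendsto_ofReal hupper)
    (Eventually.of_forall fun inr => le_iSup₂_of_le _ (isAdmissibleInput_complexGaussian S) le_rfl)
    ((eventually_gt_atTop 0).mono fun inr => capacity_le)

theorem capacity_zero (S : ℝ≥0) :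
    capacity S 0 = ENNReal.ofReal (Real.log (1 + (S : ℝ))) := by
  have hS : (0 : ℝ) < (S + 1 : ℝ≥0) := by positivity
  have hentropy : Real.log (1 + (S : ℝ)) =
      differentialEntropy (complexGaussian (S + 1)) - differentialEntropy (complexGaussian 1) := by
    rw [differentialEntropy_complexGaussian (by positivity),
      differentialEntropy_complexGaussian one_ne_zero, NNReal.coe_add, NNReal.coe_one, mul_one,
      Real.log_mul Real.pi_ne_zero (by positivity), add_comm (S : ℝ)]
    ring
  rw [hentropy]
  refine le_antisymm (iSup₂_le fun F hF => ?_) ?_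
  · have := hF.1
    have hmem := memLp_id_conv hF.memLp_id (memLp_id_complexGaussian (v := 1))
    have htest := hasSurprisal_complexGaussian (v := S + 1) (by positivity)
    rw [inputOutputInformation, inputOutputLaw_eq_additiveNoiseLaw, Real.sqrt_zero, ringLaw_zero]
    refine ((hasSurprisal_complexGaussian one_ne_zero).mutualInformation_additiveNoiseLaw_le
      htest.measurable (integrable_gaussianSurprisal _ hmem)
      htest.lintegral_exp_neg_eq_one.le).trans (ENNReal.ofReal_le_ofReal (sub_le_sub_right ?_ _))
    rw [integral_gaussianSurprisal _ hmem, differentialEntropy_complexGaussian (by positivity)]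
    exact add_le_add_right ((div_le_one hS).2 hF.integral_norm_sq_conv_complexGaussian_le) _
  · have h := inputOutputInformation_complexGaussian S 0
    rw [Real.sqrt_zero, ringLaw_zero, ringLaw_zero] at h
    exact h ▸ le_iSup₂_of_le _ (isAdmissibleInput_complexGaussian S) le_rfl

end Capacity

end RadarChannel

end

theorem theorem2 (S : ℝ≥0) :
    -- the capacity at high INR
    Tendsto (fun inr : ℝ => RadarChannel.capacity S inr) atTop
        (𝓝 (ENNReal.ofReal (1 / 2 * Real.log (1 + (S : ℝ))))) ∧
    -- twice this limit is the capacity of the interference-free channel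
    RadarChannel.capacity S 0 = ENNReal.ofReal (Real.log (1 + (S : ℝ))) ∧
    -- upper bound for every power-constrained input
    (∀ F : Measure ℂ, RadarChannel.IsAdmissibleInput S F →
      limsup (fun inr : ℝ => RadarChannel.inputOutputInformation F inr) atTop ≤
        ENNReal.ofReal (1 / 2 * Real.log (1 + (S : ℝ)))) ∧
    -- the proper-complex Gaussian input is admissible and asymptotically achieves the limit
    RadarChannel.IsAdmissibleInput S (RadarChannel.complexGaussian S) ∧
    Tendsto (fun inr : ℝ =>
        RadarChannel.inputOutputInformation (RadarChannel.complexGaussian S) inr) atTop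
      (𝓝 (ENNReal.ofReal (1 / 2 * Real.log (1 + (S : ℝ))))) := by
  refine ⟨RadarChannel.tendsto_capacity S, RadarChannel.capacity_zero S, fun F hF => ?_,
    RadarChannel.isAdmissibleInput_complexGaussian S,
    RadarChannel.tendsto_inputOutputInformation_complexGaussian S⟩
  rw [← (RadarChannel.tendsto_capacity S).limsup_eq]
  exact limsup_le_limsup (Eventually.of_forall fun inr => le_iSup₂_of_le F hF le_rfl)
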